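/- Let $G$ be a Lie groupoid over $M$ (source $s$, target $t$, unit map $\epsilon$, inversion $\iota$, multiplication $m$; $gh$ is defined when $s(g)=t(h)$), with $A=\ker(ds)|_M$ and anchor $\rho=dt:A\to TM$. Let $G_k$ be the manifold of strings $(g_1,\dots,g_k)$ with $s(g_i)=t(g_{i+1})$, $G_0=M$, $t(g_1,\dots,g_k)=t(g_1)$, and let $C^\bullet(G)$, $C^k(G)=C^\infty(G_k)$, be the differential graded algebra with product $(f\star h)(g_1,\dots,g_{k+p})=(-1)^{kp}f(g_1,\dots,g_k)h(g_{k+1},\dots,g_{k+p})$ and differential $\delta=(-1)^k\sum_{i=0}^{k+1}(-1)^i d_i^*$ on $C^k(G)$. Let $\mathrm{Ad}=A\oplus TM$ be the graded vector bundle with $A$ in degree $0$ and $TM$ in degree $1$, and let $C(G;\mathrm{Ad})^n=\Gamma(G_n,t^*A)\oplus\Gamma(G_{n-1},t^*TM)$, a graded right $C^\bullet(G)$-module by the same formula $\star$. A representation up to homotopy on $\mathrm{Ad}$ is a linear degree one operator $D$ on $C(G;\mathrm{Ad})$ with $D^2=0$ and $D(\eta\star f)=D(\eta)\star f+(-1)^{n}\eta\star\delta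 f$ for $\eta$ of total degree $n$; a morphism is a degree zero $C^\bullet(G)$-linear map commuting with the structure operators $D$. An Ehresmann connection on $G$ is a smooth right splitting $\sigma:s^*TM\to TG$ of $ds$ with $\sigma_{\epsilon(x)}=d\epsilon_x$ for all $x\in M$. Write $r_g:A_{t(g)}\to\ker(ds)_g$ for right translation, $l_g:A_{s(g)}\to\ker(dt)_g$, $l_g=d(L_g\circ\iota)$, and $\omega_g:T_gG\to A_{t(g)}$ for the map with $r\circ\omega+\sigma\circ ds=\mathrm{Id}$. Put $$\lambda_gX=dt(\sigma_gX)\ (X\in T_{s(g)}M),\qquad \lambda_g\alpha=-\omega_g(l_g\alpha)\ (\alpha\in A_{s(g)}),$$ $$K_\sigma(g,h)X=\omega_{gh}\big(dm_{g,h}(\sigma_g\lambda_hX,\sigma_hX)\big)\ (X\in T_{s(h)}M).$$ For a section $T$ over $G_j$ of $\mathrm{Hom}(s^*E,t^*E')$, $E,E'\in\{A,TM\}$, and $\eta\in\Gamma(G_k,t^*E)$ of total degree $n$, put $(T\star\eta)(g_1,\dots,g_{j+k})=(-1)^{jn}T(g_1,\dots,g_j)\,\eta(g_{j+1},\dots,g_{j+k})$.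 Let $\mathrm{Ad}_\sigma(G)$ be given by the operator $D_\sigma=\rho\star{}+\hat D_\lambda+K_\sigma\star{}$, where, for $\eta$ over $G_k$ of total degree $n$, $$\hat D_\lambda\eta(g_1,\dots,g_{k+1})=(-1)^n\Big\{\lambda_{g_1}\eta(g_2,\dots,g_{k+1})+\sum_{i=1}^k(-1)^i\eta(\dots,g_ig_{i+1},\dots)+(-1)^{k+1}\eta(g_1,\dots,g_k)\Big\}.$$ Proposition. Let $\sigma,\sigma'$ be two Ehresmann connections on $G$. Then $D_\sigma$ and $D_{\sigma'}$ are representations up to homotopy on $\mathrm{Ad}$, and $\mathrm{Ad}_\sigma(G)$ and $\mathrm{Ad}_{\sigma'}(G)$ are canonically isomorphic as representations up to homotopy. Explicitly, let $(\Psi_1)_g:T_{s(g)}M\to A_{t(g)}$ be defined by $r_g\big((\Psi_1)_gX\big)=\sigma_gX-\sigma'_gX$, and let $\Psi_0=\mathrm{Id}_{\mathrm{Ad}}$. Then $\eta\mapsto\Psi_0\star\eta+\Psi_1\star\eta$ is an isomorphism $\mathrm{Ad}_\sigma(G)\to\mathrm{Ad}_{\sigma'}(G)$, with inverse $\eta\mapsto\Psi_0\star\eta-\Psi_1\star\eta$.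 -/

import Mathlib

open scoped Manifold ContDiff

universe u₁ u₂ u₃ u₄

noncomputable section

/-! ### Lie groupoids -/

/-- A Lie groupoid with manifold of objects `M` and manifold of arrows `G`. An arrow `g` goes from
`s g` to `t g`, and `mul g h` (first `h`, then `g`) is meaningful when `s g = t h`; the values of
`mul` on other pairs play no role. The source and target are surjective submersions (surjectivity
follows from `s_one`, `t_one`), so the set of composable pairs is an embedded submanifold of
`G × G`, and smoothness of the multiplication is smoothness on that set. -/
structure LieGroupoid
    (EM : Type u₁) [NormedAddCommGroup EM] [NormedSpace ℝ EM]
    (EG : Type u₂) [NormedAddCommGroup EG] [NormedSpace ℝ EG]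
    (M : Type u₃) [TopologicalSpace M] [ChartedSpace EM M]
    (G : Type u₄) [TopologicalSpace G] [ChartedSpace EG G] where
  s : G → M
  t : G → M
  one : M → G
  inv : G → G
  mul : G → G → G
  s_submersion : Manifold.IsSubmersion 𝓘(ℝ, EG) 𝓘(ℝ, EM) ∞ s
  t_submersion : Manifold.IsSubmersion 𝓘(ℝ, EG) 𝓘(ℝ, EM) ∞ t
  one_smooth : ContMDiff 𝓘(ℝ, EM) 𝓘(ℝ, EG) ∞ one
  inv_smooth : ContMDiff 𝓘(ℝ, EG) 𝓘(ℝ, EG) ∞ inv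
  mul_smooth : ContMDiffOn (𝓘(ℝ, EG).prod 𝓘(ℝ, EG)) 𝓘(ℝ, EG) ∞
    (fun p : G × G => mul p.1 p.2) {p : G × G | s p.1 = t p.2}
  s_one : ∀ x, s (one x) = x
  t_one : ∀ x, t (one x) = x
  s_inv : ∀ g, s (inv g) = t g
  t_inv : ∀ g, t (inv g) = s g
  s_mul : ∀ g h, s g = t h → s (mul g h) = s h
  t_mul : ∀ g h, s g = t h → t (mul g h) = t g
  mul_assoc : ∀ g h k, s g = t h → s h = t k → mul (mul g h) k = mul g (mul h k)
  mul_one : ∀ g, mul g (one (s g)) = g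
  one_mul : ∀ g, mul (one (t g)) g = g
  mul_inv : ∀ g, mul g (inv g) = one (t g)
  inv_mul : ∀ g, mul (inv g) g = one (s g)

section Tangent

variable {E : Type*} [NormedAddCommGroup E] [NormedSpace ℝ E]
  {X : Type*} [TopologicalSpace X] [ChartedSpace E X]

/-- Transport of tangent vectors along an equality of base points. -/
def tcast {x y : X} (h : x = y) :
    TangentSpace 𝓘(ℝ, E) x →L[ℝ] TangentSpace 𝓘(ℝ, E) y :=
  h ▸ ContinuousLinearMap.id ℝ (TangentSpace 𝓘(ℝ, E) x)

/-- The family of tangent vectors `v u ∈ T_{c u} X`, `u ∈ ℝᵈ`, is smooth, i.e. `u ↦ v u` is a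
smooth map from `ℝᵈ` to the tangent bundle of `X`. -/
def SmoothAlong [IsManifold 𝓘(ℝ, E) ∞ X] {d : ℕ} (c : EuclideanSpace ℝ (Fin d) → X)
    (v : ∀ u, TangentSpace 𝓘(ℝ, E) (c u)) : Prop :=
  ContMDiff 𝓘(ℝ, EuclideanSpace ℝ (Fin d)) 𝓘(ℝ, E).tangent ∞
    (fun u => (⟨c u, v u⟩ : TangentBundle 𝓘(ℝ, E) X))

variable [IsManifold 𝓘(ℝ, E) ∞ X] {d : ℕ} {c : EuclideanSpace ℝ (Fin d) → X}

theorem smoothAlong_iff (v : ∀ u, TangentSpace 𝓘(ℝ, E) (c u)) :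
    SmoothAlong c v ↔ ∀ u₀, ContMDiffAt 𝓘(ℝ, EuclideanSpace ℝ (Fin d)) 𝓘(ℝ, E) ∞ c u₀ ∧
      ContMDiffAt 𝓘(ℝ, EuclideanSpace ℝ (Fin d)) 𝓘(ℝ, E) ∞
        (fun u => (trivializationAt E (TangentSpace 𝓘(ℝ, E) : X → Type _) (c u₀)
          ⟨c u, v u⟩).2) u₀ := by
  refine forall_congr' fun u₀ => ?_
  exact Bundle.contMDiffAt_totalSpace (F := E) (E := (TangentSpace 𝓘(ℝ, E) : X → Type _))

theorem SmoothAlong.smooth_base {v : ∀ u, TangentSpace 𝓘(ℝ, E) (c u)} (hv : SmoothAlong c v) :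
    ContMDiff 𝓘(ℝ, EuclideanSpace ℝ (Fin d)) 𝓘(ℝ, E) ∞ c :=
  fun u => ((smoothAlong_iff v).1 hv u).1

theorem smoothAlong_linear_aux (hc : ContMDiff 𝓘(ℝ, EuclideanSpace ℝ (Fin d)) 𝓘(ℝ, E) ∞ c)
    (u₀ : EuclideanSpace ℝ (Fin d)) :
    ∀ᶠ u in nhds u₀, c u ∈ (trivializationAt E (TangentSpace 𝓘(ℝ, E) : X → Type _)
      (c u₀)).baseSet :=
  hc.continuous.continuousAt.eventually_mem
    ((trivializationAt E (TangentSpace 𝓘(ℝ, E) : X → Type _) (c u₀)).open_baseSet.mem_nhds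
      (FiberBundle.mem_baseSet_trivializationAt' (c u₀)))

theorem SmoothAlong.add {v w : ∀ u, TangentSpace 𝓘(ℝ, E) (c u)}
    (hv : SmoothAlong c v) (hw : SmoothAlong c w) : SmoothAlong c (fun u => v u + w u) := by
  rw [smoothAlong_iff]
  intro u₀
  refine ⟨hv.smooth_base u₀, ?_⟩
  refine ((((smoothAlong_iff v).1 hv u₀).2).add (((smoothAlong_iff w).1 hw u₀).2)).congr_of_eventuallyEq ?_
  filter_upwards [smoothAlong_linear_aux hv.smooth_base u₀] with u hu
  exact ((trivializationAt E (TangentSpace 𝓘(ℝ, E) : X → Type _) (c u₀)).linear ℝ hu).1 _ _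

theorem SmoothAlong.smul {f : EuclideanSpace ℝ (Fin d) → ℝ}
    (hf : ContMDiff 𝓘(ℝ, EuclideanSpace ℝ (Fin d)) 𝓘(ℝ, ℝ) ∞ f)
    {v : ∀ u, TangentSpace 𝓘(ℝ, E) (c u)} (hv : SmoothAlong c v) :
    SmoothAlong c (fun u => f u • v u) := by
  rw [smoothAlong_iff]
  intro u₀
  refine ⟨hv.smooth_base u₀, ?_⟩
  refine ((hf u₀).smul (((smoothAlong_iff v).1 hv u₀).2)).congr_of_eventuallyEq ?_
  filter_upwards [smoothAlong_linear_aux hv.smooth_base u₀] with u hu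
  exact ((trivializationAt E (TangentSpace 𝓘(ℝ, E) : X → Type _) (c u₀)).linear ℝ hu).2 _ _

theorem SmoothAlong.zero (hc : ContMDiff 𝓘(ℝ, EuclideanSpace ℝ (Fin d)) 𝓘(ℝ, E) ∞ c) :
    SmoothAlong c (fun u => (0 : TangentSpace 𝓘(ℝ, E) (c u))) := by
  rw [smoothAlong_iff]
  intro u₀
  refine ⟨hc u₀, ?_⟩
  refine (contMDiffAt_const (c := (0 : E))).congr_of_eventuallyEq ?_
  filter_upwards [smoothAlong_linear_aux hc u₀] with u hu
  exact ((trivializationAt E (TangentSpace 𝓘(ℝ, E) : X → Type _) (c u₀)).linear ℝ hu).map_zero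

theorem SmoothAlong.sum (hc : ContMDiff 𝓘(ℝ, EuclideanSpace ℝ (Fin d)) 𝓘(ℝ, E) ∞ c)
    {ι : Type*} (S : Finset ι) (v : ι → ∀ u, TangentSpace 𝓘(ℝ, E) (c u))
    (hv : ∀ i ∈ S, SmoothAlong c (v i)) : SmoothAlong c (fun u => ∑ i ∈ S, v i u) := by
  classical
  induction S using Finset.induction_on with
  | empty => simpa using SmoothAlong.zero hc
  | insert i S hi ih =>
    simp only [Finset.sum_insert hi]
    exact (hv i (Finset.mem_insert_self i S)).add
      (ih fun j hj => hv j (Finset.mem_insert_of_mem hj))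

end Tangent

namespace LieGroupoid

variable {EM : Type u₁} [NormedAddCommGroup EM] [NormedSpace ℝ EM]
  {EG : Type u₂} [NormedAddCommGroup EG] [NormedSpace ℝ EG]
  {M : Type u₃} [TopologicalSpace M] [ChartedSpace EM M]
  {G : Type u₄} [TopologicalSpace G] [ChartedSpace EG G]

section Pointwise

variable (𝒢 : LieGroupoid EM EG M G)

theorem inv_one (x : M) : 𝒢.inv (𝒢.one x) = 𝒢.one x := by
  have h1 := 𝒢.mul_one (𝒢.inv (𝒢.one x))
  have h2 := 𝒢.inv_mul (𝒢.one x)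
  rw [𝒢.s_inv, 𝒢.t_one] at h1
  rw [𝒢.s_one] at h2
  exact h1.symm.trans h2

theorem inv_one_s (g : G) : 𝒢.inv (𝒢.one (𝒢.s g)) = 𝒢.one (𝒢.s g) := 𝒢.inv_one _

/-- The differential `ds : T_g G → T_{s g} M`. -/
def ds (g : G) : TangentSpace 𝓘(ℝ, EG) g →L[ℝ] TangentSpace 𝓘(ℝ, EM) (𝒢.s g) :=
  mfderiv 𝓘(ℝ, EG) 𝓘(ℝ, EM) 𝒢.s g

/-- The differential `dt : T_g G → T_{t g} M`. -/
def dt (g : G) : TangentSpace 𝓘(ℝ, EG) g →L[ℝ] TangentSpace 𝓘(ℝ, EM) (𝒢.t g) :=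
  mfderiv 𝓘(ℝ, EG) 𝓘(ℝ, EM) 𝒢.t g

/-- The differential `(dm)_{g,h}(u, v)` of the multiplication at a composable pair `(g, h)`, for
`(u, v)` tangent to the manifold of composable pairs, i.e. with `ds u = dt v` (the value of
`mfderivWithin` on such vectors does not depend on the choice of a derivative). -/
def dmul (g h : G) (u : TangentSpace 𝓘(ℝ, EG) g) (v : TangentSpace 𝓘(ℝ, EG) h) :
    TangentSpace 𝓘(ℝ, EG) (𝒢.mul g h) :=
  mfderivWithin (𝓘(ℝ, EG).prod 𝓘(ℝ, EG)) 𝓘(ℝ, EG) (fun p : G × G => 𝒢.mul p.1 p.2)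
    {p : G × G | 𝒢.s p.1 = 𝒢.t p.2} (g, h) ((u, v) : EG × EG)

/-- The fibre `A_x = Ker (ds)_{1_x}` of the Lie algebroid. -/
def A (x : M) : Submodule ℝ (TangentSpace 𝓘(ℝ, EG) (𝒢.one x)) :=
  LinearMap.ker (𝒢.ds (𝒢.one x)).toLinearMap

/-- The anchor `ρ = dt : A_x → T_x M`. -/
def anchor (x : M) (a : TangentSpace 𝓘(ℝ, EG) (𝒢.one x)) : TangentSpace 𝓘(ℝ, EM) x :=
  tcast (𝒢.t_one x) (𝒢.dt (𝒢.one x) a)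

/-- The inverse of right translation `r_g = (dR_g)_{1_{t g}} : A_{t g} → Ker (ds)_g`, that is,
right translation by `g⁻¹`: it maps `W ∈ Ker (ds)_g` to `dR_{g⁻¹} W = dm(W, 0) ∈ A_{t g}`. -/
def rInv (g : G) (W : TangentSpace 𝓘(ℝ, EG) g) :
    TangentSpace 𝓘(ℝ, EG) (𝒢.one (𝒢.t g)) :=
  tcast (𝒢.mul_inv g) (𝒢.dmul g (𝒢.inv g) W 0)

/-- Left translation `l_g : A_{s g} → Ker (dt)_g`, `l_g α = d(L_g ∘ ι) α = dm(0, dι α)`. -/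
def lTrans (g : G) (a : TangentSpace 𝓘(ℝ, EG) (𝒢.one (𝒢.s g))) : TangentSpace 𝓘(ℝ, EG) g :=
  tcast (𝒢.mul_one g) (𝒢.dmul g (𝒢.one (𝒢.s g)) 0
    (tcast (𝒢.inv_one_s g) (mfderiv 𝓘(ℝ, EG) 𝓘(ℝ, EG) 𝒢.inv (𝒢.one (𝒢.s g)) a)))

end Pointwise

section NerveSection

variable (𝒢 : LieGroupoid EM EG M G)

/-! ### The nerve -/

/-- The set `G_n` of strings `(g_1, …, g_n)` of composable arrows, where `g_{i+1} = arr i`, recorded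
together with the objects `vert 0 = t g_1`, `vert i = s g_i`; for `n = 0` this is `M`. -/
@[ext]
structure Nerve (n : ℕ) where
  vert : Fin (n + 1) → M
  arr : Fin n → G
  t_arr : ∀ i, 𝒢.t (arr i) = vert i.castSucc
  s_arr : ∀ i, 𝒢.s (arr i) = vert i.succ

variable {𝒢}

/-- A smooth map `ℝᵈ → G_n`. A map out of `G_n` (an embedded submanifold of `M^{n+1} × G^n`) is
smooth iff its composition with all smooth maps `ℝᵈ → G_n`, `d ≥ 0`, is smooth. -/
def IsSmoothFamily {n d : ℕ} (p : EuclideanSpace ℝ (Fin d) → 𝒢.Nerve n) : Prop :=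
  (∀ i, ContMDiff 𝓘(ℝ, EuclideanSpace ℝ (Fin d)) 𝓘(ℝ, EM) ∞ (fun u => (p u).vert i)) ∧
    ∀ i, ContMDiff 𝓘(ℝ, EuclideanSpace ℝ (Fin d)) 𝓘(ℝ, EG) ∞ (fun u => (p u).arr i)

namespace Nerve

/-- The target `t(g_1, …, g_n) = t(g_1)`. -/
def tgt {n : ℕ} (p : 𝒢.Nerve n) : M := p.vert 0

theorem composable {n : ℕ} (p : 𝒢.Nerve n) (j : ℕ) (hj : j + 1 < n) :
    𝒢.s (p.arr ⟨j, by omega⟩) = 𝒢.t (p.arr ⟨j + 1, hj⟩) := by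
  rw [p.s_arr, p.t_arr]; rfl

/-- The face maps `d_i : G_{n+1} → G_n`: `d_0` drops `g_1`, `d_{n+1}` drops `g_{n+1}`, and
`d_i` replaces `g_i, g_{i+1}` by `g_i g_{i+1}` for `0 < i < n + 1`. -/
def face {n : ℕ} (i : Fin (n + 2)) (p : 𝒢.Nerve (n + 1)) : 𝒢.Nerve n where
  vert j := p.vert (i.succAbove j)
  arr j :=
    if j.val + 1 < i.val then p.arr j.castSucc
    else if j.val + 1 = i.val then 𝒢.mul (p.arr j.castSucc) (p.arr j.succ)
    else p.arr j.succ
  t_arr j := by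
    have hc : 𝒢.s (p.arr j.castSucc) = 𝒢.t (p.arr j.succ) := p.composable j.val (by omega)
    split_ifs with h1 h2
    all_goals
      try rw [𝒢.t_mul _ _ hc]
      rw [p.t_arr]; congr 1; ext; simp [Fin.succAbove, Fin.lt_def]; grind
  s_arr j := by
    have hc : 𝒢.s (p.arr j.castSucc) = 𝒢.t (p.arr j.succ) := p.composable j.val (by omega)
    split_ifs with h1 h2
    all_goals
      try rw [𝒢.s_mul _ _ hc]
      rw [p.s_arr]; congr 1; ext; simp [Fin.succAbove, Fin.lt_def]; try grind

/-- `(g_1, …, g_n) ↦ (g_1, …, g_k)`. -/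
def front {n : ℕ} (k : ℕ) (hk : k ≤ n) (p : 𝒢.Nerve n) : 𝒢.Nerve k where
  vert j := p.vert ⟨j.val, by omega⟩
  arr j := p.arr ⟨j.val, by omega⟩
  t_arr j := p.t_arr _
  s_arr j := p.s_arr _

/-- `(g_1, …, g_n) ↦ (g_{k+1}, …, g_n)`. -/
def back {n : ℕ} (k : ℕ) (hk : k ≤ n) (p : 𝒢.Nerve n) : 𝒢.Nerve (n - k) where
  vert j := p.vert ⟨k + j.val, by omega⟩
  arr j := p.arr ⟨k + j.val, by omega⟩
  t_arr j := p.t_arr _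
  s_arr j := p.s_arr _

theorem tgt_front {n : ℕ} (k : ℕ) (hk : k ≤ n) (p : 𝒢.Nerve n) : (p.front k hk).tgt = p.tgt :=
  rfl

theorem tgt_face_succ {n : ℕ} (i : Fin (n + 1)) (p : 𝒢.Nerve (n + 1)) :
    (p.face i.succ).tgt = p.tgt := by
  simp [tgt, face]

theorem t_arr_zero {n : ℕ} (p : 𝒢.Nerve (n + 1)) : 𝒢.t (p.arr 0) = p.tgt := p.t_arr 0

theorem tgt_face_zero {n : ℕ} (p : 𝒢.Nerve (n + 1)) : (p.face 0).tgt = 𝒢.s (p.arr 0) := by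
  rw [p.s_arr]; simp [tgt, face]

theorem s_arr_zero {n : ℕ} (p : 𝒢.Nerve (n + 2)) : 𝒢.s (p.arr 0) = 𝒢.t (p.arr 1) :=
  p.composable 0 (by omega)

theorem tgt_face_zero_zero {n : ℕ} (p : 𝒢.Nerve (n + 2)) :
    ((p.face 0).face 0).tgt = 𝒢.s (p.arr 1) := by
  rw [tgt_face_zero]; simp [face]

end Nerve

theorem IsSmoothFamily.front {n d : ℕ} {p : EuclideanSpace ℝ (Fin d) → 𝒢.Nerve n}
    (hp : IsSmoothFamily p) (k : ℕ) (hk : k ≤ n) : IsSmoothFamily fun u => (p u).front k hk :=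
  ⟨fun _ => hp.1 _, fun _ => hp.2 _⟩

theorem IsSmoothFamily.back {n d : ℕ} {p : EuclideanSpace ℝ (Fin d) → 𝒢.Nerve n}
    (hp : IsSmoothFamily p) (k : ℕ) (hk : k ≤ n) : IsSmoothFamily fun u => (p u).back k hk :=
  ⟨fun _ => hp.1 _, fun _ => hp.2 _⟩

end NerveSection

/-! ### Connections -/

/-- An Ehresmann connection on `𝒢`, as a smooth splitting `σ : s^*TM → TG` of `ds` which at the
units is the natural splitting `dε`. A fibrewise linear map `s^*TM → TG` is smooth iff it takes
smooth families `(g u, X u)`, `X u ∈ T_{s (g u)} M`, to smooth families. -/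
structure Connection [IsManifold 𝓘(ℝ, EM) ∞ M] [IsManifold 𝓘(ℝ, EG) ∞ G]
    (𝒢 : LieGroupoid EM EG M G) where
  σ : ∀ g : G, TangentSpace 𝓘(ℝ, EM) (𝒢.s g) →L[ℝ] TangentSpace 𝓘(ℝ, EG) g
  smooth : ∀ (d : ℕ) (g : EuclideanSpace ℝ (Fin d) → G)
    (X : ∀ u, TangentSpace 𝓘(ℝ, EM) (𝒢.s (g u))),
    ContMDiff 𝓘(ℝ, EuclideanSpace ℝ (Fin d)) 𝓘(ℝ, EG) ∞ g →
    SmoothAlong (fun u => 𝒢.s (g u)) X → SmoothAlong g (fun u => σ (g u) (X u))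
  ds_σ : ∀ (g : G) (X : TangentSpace 𝓘(ℝ, EM) (𝒢.s g)), 𝒢.ds g (σ g X) = X
  σ_one : ∀ (x : M) (X : TangentSpace 𝓘(ℝ, EM) x),
    σ (𝒢.one x) (tcast (𝒢.s_one x).symm X) = mfderiv 𝓘(ℝ, EM) 𝓘(ℝ, EG) 𝒢.one x X

section Operators

variable [IsManifold 𝓘(ℝ, EM) ∞ M] [IsManifold 𝓘(ℝ, EG) ∞ G]
  (𝒢 : LieGroupoid EM EG M G)

section Conn

variable {𝒢}

/-- The left splitting `ω_g : T_g G → A_{t g}`, determined by `r ∘ ω + σ ∘ ds = id`. -/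
def Connection.ω (c : 𝒢.Connection) (g : G) (V : TangentSpace 𝓘(ℝ, EG) g) :
    TangentSpace 𝓘(ℝ, EG) (𝒢.one (𝒢.t g)) :=
  𝒢.rInv g (V - c.σ g (𝒢.ds g V))

/-- The quasi-action on `TM`: `λ_g X = dt (σ_g X)`. -/
def Connection.lamT (c : 𝒢.Connection) (g : G) (X : TangentSpace 𝓘(ℝ, EM) (𝒢.s g)) :
    TangentSpace 𝓘(ℝ, EM) (𝒢.t g) :=
  𝒢.dt g (c.σ g X)

/-- The quasi-action on `A`: `λ_g α = - ω_g (l_g α)`. -/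
def Connection.lamA (c : 𝒢.Connection) (g : G)
    (a : TangentSpace 𝓘(ℝ, EG) (𝒢.one (𝒢.s g))) : TangentSpace 𝓘(ℝ, EG) (𝒢.one (𝒢.t g)) :=
  - c.ω g (𝒢.lTrans g a)

/-- The basic curvature, `K(g,h) X = ω_{gh} (dm_{g,h} (σ_g (λ_h X), σ_h X))`, i.e. the element of
`A_{t g}` whose right translate to `gh` is `dm_{g,h} (σ_g (λ_h X), σ_h X) - σ_{gh} X`. -/
def Connection.K (c : 𝒢.Connection) (g h : G) (hc : 𝒢.s g = 𝒢.t h)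
    (X : TangentSpace 𝓘(ℝ, EM) (𝒢.s h)) : TangentSpace 𝓘(ℝ, EG) (𝒢.one (𝒢.t g)) :=
  tcast (congrArg 𝒢.one (𝒢.t_mul g h hc))
    (c.ω (𝒢.mul g h) (𝒢.dmul g h (c.σ g (tcast hc.symm (c.lamT h X))) (c.σ h X)))

/-- `Ψ₁ = σ - σ'`: the element of `A_{t g}` whose right translate to `g` is `σ_g X - σ'_g X`. -/
def Connection.psi1 (c c' : 𝒢.Connection) (g : G) (X : TangentSpace 𝓘(ℝ, EM) (𝒢.s g)) :
    TangentSpace 𝓘(ℝ, EG) (𝒢.one (𝒢.t g)) :=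
  𝒢.rInv g (c.σ g X - c'.σ g X)

end Conn

/-! ### Cochains -/

/-- Families of functions on the `G_n`, with no smoothness imposed. -/
abbrev RawScalar : Type (max u₃ u₄) := ∀ n : ℕ, 𝒢.Nerve n → ℝ

/-- The differentiable cochains `C(G) = ⊕ C^n(G)`, `C^n(G) = C^∞(G_n)`. -/
def IsCochain (f : 𝒢.RawScalar) : Prop :=
  (∀ (n d : ℕ) (p : EuclideanSpace ℝ (Fin d) → 𝒢.Nerve n), IsSmoothFamily p →
      ContMDiff 𝓘(ℝ, EuclideanSpace ℝ (Fin d)) 𝓘(ℝ, ℝ) ∞ (fun u => f n (p u))) ∧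
    ∃ N, ∀ n, N ≤ n → f n = 0

variable {𝒢}

/-- The differential `δ f = (-1)^n ∑ (-1)^i d_i^* f`, `f ∈ C^n(G)`, of `C(G)`. -/
def scalarδ (f : 𝒢.RawScalar) : 𝒢.RawScalar
  | 0, _ => 0
  | n + 1, p => (-1) ^ n * ∑ i : Fin (n + 2), (-1) ^ (i : ℕ) * f n (p.face i)

variable (𝒢)

/-- Families of a vector in `T_{1_{t p}} G` (first component) and a vector in `T_{t p} M` (second
component) for `p ∈ G_n`, `n ≥ 0`, with no smoothness imposed. -/
abbrev RawCochain : Type (max u₁ u₂ u₃ u₄) :=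
  (∀ (n : ℕ) (p : 𝒢.Nerve n), TangentSpace 𝓘(ℝ, EG) (𝒢.one p.tgt)) ×
    (∀ (n : ℕ) (p : 𝒢.Nerve n), TangentSpace 𝓘(ℝ, EM) p.tgt)

/-- The cochains `C(G; Ad) = ⊕_k Γ(G_k, t^*A) ⊕ Γ(G_k, t^*TM)` with values in the graded vector
bundle `Ad = A ⊕ TM`, with `A` in degree `0` and `TM` in degree `1`. The component `η.1 k` is in
bidegree `(k, 0)` and the component `η.2 k` in bidegree `(k, 1)`. As `A` is a subbundle of the
restriction of `TG` to the units, smoothness of a section of `t^*A` is smoothness as a map to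
`TG`. -/
def AdCochain : Submodule ℝ 𝒢.RawCochain where
  carrier := {η |
    (∀ n p, η.1 n p ∈ 𝒢.A p.tgt) ∧
    (∀ (n d : ℕ) (p : EuclideanSpace ℝ (Fin d) → 𝒢.Nerve n), IsSmoothFamily p →
      SmoothAlong (fun u => 𝒢.one (p u).tgt) (fun u => η.1 n (p u)) ∧
        SmoothAlong (fun u => (p u).tgt) (fun u => η.2 n (p u))) ∧
    ∃ N, ∀ n, N ≤ n → η.1 n = 0 ∧ η.2 n = 0}
  add_mem' {η ζ} hη hζ := by
    refine ⟨fun n p => (𝒢.A p.tgt).add_mem (hη.1 n p) (hζ.1 n p), fun n d p hp =>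
      ⟨(hη.2.1 n d p hp).1.add (hζ.2.1 n d p hp).1,
        (hη.2.1 n d p hp).2.add (hζ.2.1 n d p hp).2⟩, ?_⟩
    obtain ⟨N, hN⟩ := hη.2.2
    obtain ⟨N', hN'⟩ := hζ.2.2
    refine ⟨max N N', fun n hn => ?_⟩
    have h1 := hN n (le_trans (le_max_left _ _) hn)
    have h2 := hN' n (le_trans (le_max_right _ _) hn)
    exact ⟨by simp [h1.1, h2.1], by simp [h1.2, h2.2]⟩
  zero_mem' := by
    refine ⟨fun n p => (𝒢.A p.tgt).zero_mem, fun n d p hp => ⟨?_, ?_⟩, 0, fun n _ => ⟨rfl, rfl⟩⟩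
    · exact SmoothAlong.zero (𝒢.one_smooth.comp (hp.1 0))
    · exact SmoothAlong.zero (hp.1 0)
  smul_mem' r η hη := by
    refine ⟨fun n p => (𝒢.A p.tgt).smul_mem r (hη.1 n p), fun n d p hp =>
      ⟨SmoothAlong.smul contMDiff_const (hη.2.1 n d p hp).1,
        SmoothAlong.smul contMDiff_const (hη.2.1 n d p hp).2⟩, ?_⟩
    obtain ⟨N, hN⟩ := hη.2.2
    refine ⟨N, fun n hn => ?_⟩
    have h1 := hN n hn
    exact ⟨by simp [h1.1], by simp [h1.2]⟩

/-- The part `C(G; Ad)^n = Γ(G_n, t^*A) ⊕ Γ(G_{n-1}, t^*TM)` of total degree `n`. -/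
def IsHomogeneous (n : ℕ) (η : 𝒢.RawCochain) : Prop :=
  (∀ k, k ≠ n → η.1 k = 0) ∧ ∀ k, k + 1 ≠ n → η.2 k = 0

variable {𝒢}

/-- The right module structure over `C(G)`:
`(η ⋆ f)(g_1, …, g_{k+k'}) = (-1)^{kk'} f(g_{k+1}, …, g_{k+k'}) η(g_1, …, g_k)` for `η` of cocycle
degree `k` and `f ∈ C^{k'}(G)`. -/
def rawStar (η : 𝒢.RawCochain) (f : 𝒢.RawScalar) : 𝒢.RawCochain :=
  (fun n p => ∑ k : Fin (n + 1), ((-1) ^ (k.val * (n - k.val)) * f (n - k.val)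
      (p.back k.val (Nat.le_of_lt_succ k.isLt))) •
        (η.1 k.val (p.front k.val (Nat.le_of_lt_succ k.isLt)) :
          TangentSpace 𝓘(ℝ, EG) (𝒢.one p.tgt)),
    fun n p => ∑ k : Fin (n + 1), ((-1) ^ (k.val * (n - k.val)) * f (n - k.val)
      (p.back k.val (Nat.le_of_lt_succ k.isLt))) •
        (η.2 k.val (p.front k.val (Nat.le_of_lt_succ k.isLt)) : TangentSpace 𝓘(ℝ, EM) p.tgt))

theorem rawStar_mem {η : 𝒢.RawCochain} (hη : η ∈ 𝒢.AdCochain) {f : 𝒢.RawScalar}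
    (hf : 𝒢.IsCochain f) : rawStar η f ∈ 𝒢.AdCochain := by
  obtain ⟨hA, hs, N, hN⟩ := hη
  obtain ⟨hfs, N', hN'⟩ := hf
  refine ⟨fun n p => ?_, fun n d p hp => ⟨?_, ?_⟩, N + N', fun n hn =>
    ⟨funext fun p => ?_, funext fun p => ?_⟩⟩
  · refine Submodule.sum_mem (𝒢.A p.tgt) (t := Finset.univ) (f := fun k : Fin (n + 1) =>
      ((-1) ^ (k.val * (n - k.val)) * f (n - k.val)
        (p.back k.val (Nat.le_of_lt_succ k.isLt))) •
          (η.1 k.val (p.front k.val (Nat.le_of_lt_succ k.isLt)) :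
            TangentSpace 𝓘(ℝ, EG) (𝒢.one p.tgt))) fun k _ => ?_
    exact (𝒢.A p.tgt).smul_mem _ (hA k.val (p.front k.val (Nat.le_of_lt_succ k.isLt)))
  · refine SmoothAlong.sum (c := fun u => 𝒢.one (p u).tgt)
      (𝒢.one_smooth.comp (hp.1 0)) Finset.univ (fun (k : Fin (n + 1)) u =>
        ((-1) ^ (k.val * (n - k.val)) * f (n - k.val)
          ((p u).back k.val (Nat.le_of_lt_succ k.isLt))) •
            (η.1 k.val ((p u).front k.val (Nat.le_of_lt_succ k.isLt)) :
              TangentSpace 𝓘(ℝ, EG) (𝒢.one (p u).tgt))) fun k _ => ?_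
    exact SmoothAlong.smul (contMDiff_const.mul (hfs _ d _ (hp.back _ _)))
      (hs k.val d _ (hp.front _ (Nat.le_of_lt_succ k.isLt))).1
  · refine SmoothAlong.sum (c := fun u => (p u).tgt) (hp.1 0) Finset.univ
      (fun (k : Fin (n + 1)) u =>
        ((-1) ^ (k.val * (n - k.val)) * f (n - k.val)
          ((p u).back k.val (Nat.le_of_lt_succ k.isLt))) •
            (η.2 k.val ((p u).front k.val (Nat.le_of_lt_succ k.isLt)) :
              TangentSpace 𝓘(ℝ, EM) (p u).tgt)) fun k _ => ?_
    exact SmoothAlong.smul (contMDiff_const.mul (hfs _ d _ (hp.back _ _)))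
      (hs k.val d _ (hp.front _ (Nat.le_of_lt_succ k.isLt))).2
  · refine Finset.sum_eq_zero (s := Finset.univ) (f := fun k : Fin (n + 1) =>
      ((-1) ^ (k.val * (n - k.val)) * f (n - k.val)
        (p.back k.val (Nat.le_of_lt_succ k.isLt))) •
          (η.1 k.val (p.front k.val (Nat.le_of_lt_succ k.isLt)) :
            TangentSpace 𝓘(ℝ, EG) (𝒢.one p.tgt))) fun k _ => ?_
    by_cases h : N ≤ k.val
    · have h0 : η.1 k.val (p.front k.val (Nat.le_of_lt_succ k.isLt)) = 0 :=
        congrFun (hN _ h).1 _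
      exact smul_eq_zero_of_right _ h0
    · have h0 : f (n - k.val) (p.back k.val (Nat.le_of_lt_succ k.isLt)) = 0 :=
        congrFun (hN' (n - k.val) (by omega)) _
      exact smul_eq_zero_of_left (by rw [h0, mul_zero]) _
  · refine Finset.sum_eq_zero (s := Finset.univ) (f := fun k : Fin (n + 1) =>
      ((-1) ^ (k.val * (n - k.val)) * f (n - k.val)
        (p.back k.val (Nat.le_of_lt_succ k.isLt))) •
          (η.2 k.val (p.front k.val (Nat.le_of_lt_succ k.isLt)) :
            TangentSpace 𝓘(ℝ, EM) p.tgt)) fun k _ => ?_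
    by_cases h : N ≤ k.val
    · have h0 : η.2 k.val (p.front k.val (Nat.le_of_lt_succ k.isLt)) = 0 :=
        congrFun (hN _ h).2 _
      exact smul_eq_zero_of_right _ h0
    · have h0 : f (n - k.val) (p.back k.val (Nat.le_of_lt_succ k.isLt)) = 0 :=
        congrFun (hN' (n - k.val) (by omega)) _
      exact smul_eq_zero_of_left (by rw [h0, mul_zero]) _

/-- `η ⋆ f ∈ C(G; Ad)` for `η ∈ C(G; Ad)` and `f ∈ C(G)`. -/
def star (η : 𝒢.AdCochain) (f : 𝒢.RawScalar) (hf : 𝒢.IsCochain f) : 𝒢.AdCochain :=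
  ⟨rawStar η f, rawStar_mem η.2 hf⟩

/-! ### Representations up to homotopy -/

variable (𝒢)

/-- A representation up to homotopy of `𝒢` on the graded vector bundle `Ad = A ⊕ TM`: a linear
degree one operator `D` on `C(G; Ad)` with `D² = 0` satisfying the Leibniz identity. -/
structure AdRep where
  D : 𝒢.AdCochain →ₗ[ℝ] 𝒢.AdCochain
  degree_one : ∀ (n : ℕ) (η : 𝒢.AdCochain), 𝒢.IsHomogeneous n η.1 → 𝒢.IsHomogeneous (n + 1) (D η).1
  sq_zero : ∀ η, D (D η) = 0
  leibniz : ∀ (n : ℕ) (η : 𝒢.AdCochain) (f : 𝒢.RawScalar) (hf : 𝒢.IsCochain f),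
    𝒢.IsHomogeneous n η.1 →
      (D (star η f hf) : 𝒢.RawCochain) =
        rawStar (D η).1 f + (-1 : ℝ) ^ n • rawStar η.1 (scalarδ f)

variable {𝒢}

/-- A morphism of representations up to homotopy: a degree zero `C(G)`-linear map commuting with
the structure operators. -/
structure AdRep.Hom (R R' : 𝒢.AdRep) where
  toLin : 𝒢.AdCochain →ₗ[ℝ] 𝒢.AdCochain
  degree_zero : ∀ (n : ℕ) (η : 𝒢.AdCochain),
    𝒢.IsHomogeneous n η.1 → 𝒢.IsHomogeneous n (toLin η).1
  map_star : ∀ (η : 𝒢.AdCochain) (f : 𝒢.RawScalar) (hf : 𝒢.IsCochain f),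
    toLin (star η f hf) = star (toLin η) f hf
  comm : ∀ η, toLin (R.D η) = R'.D (toLin η)

/-- An isomorphism of representations up to homotopy. -/
structure AdRep.Iso (R R' : 𝒢.AdRep) where
  hom : AdRep.Hom R R'
  inv : AdRep.Hom R' R
  hom_inv : ∀ η, inv.toLin (hom.toLin η) = η
  inv_hom : ∀ η, hom.toLin (inv.toLin η) = η

/-! ### The adjoint representation -/

/-- The operator `η ↦ R_0 ⋆ η` for `R_0 = ρ : A → TM`. -/
def anchorOp (η : 𝒢.RawCochain) : 𝒢.RawCochain :=
  (0, fun n p => 𝒢.anchor p.tgt (η.1 n p))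

/-- The operator `D̂_λ` of the graded quasi-action `R_1 = λ`: for `η` of bidegree `(k, l)`,
`(D̂_λ η)(g_1, …, g_{k+1}) = (-1)^{k+l} (λ_{g_1} η(g_2, …, g_{k+1})
  + ∑_{i=1}^{k} (-1)^i η(…, g_i g_{i+1}, …) + (-1)^{k+1} η(g_1, …, g_k))`. -/
def quasiOp (c : 𝒢.Connection) (η : 𝒢.RawCochain) : 𝒢.RawCochain :=
  (fun n => match n with
    | 0 => fun _ => 0
    | k + 1 => fun p => (-1 : ℝ) ^ k •
        (tcast (congrArg 𝒢.one p.t_arr_zero)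
            (c.lamA (p.arr 0) (tcast (congrArg 𝒢.one p.tgt_face_zero) (η.1 k (p.face 0)))) +
          ∑ i : Fin (k + 1), (-1 : ℝ) ^ (i.val + 1) •
            (tcast (congrArg 𝒢.one (p.tgt_face_succ i)) (η.1 k (p.face i.succ)))),
   fun n => match n with
    | 0 => fun _ => 0
    | k + 1 => fun p => (-1 : ℝ) ^ (k + 1) •
        (tcast p.t_arr_zero (c.lamT (p.arr 0) (tcast p.tgt_face_zero (η.2 k (p.face 0)))) +
          ∑ i : Fin (k + 1), (-1 : ℝ) ^ (i.val + 1) •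
            (tcast (p.tgt_face_succ i) (η.2 k (p.face i.succ)))))

/-- The operator `η ↦ R_2 ⋆ η` for `R_2 = K : TM → A`, that is,
`(R_2 ⋆ η)(g_1, …, g_{k+2}) = K(g_1, g_2) η(g_3, …, g_{k+2})`. -/
def curvOp (c : 𝒢.Connection) (η : 𝒢.RawCochain) : 𝒢.RawCochain :=
  (fun n => match n with
    | 0 => fun _ => 0
    | 1 => fun _ => 0
    | k + 2 => fun p => tcast (congrArg 𝒢.one p.t_arr_zero)
        (c.K (p.arr 0) (p.arr 1) p.s_arr_zero
          (tcast p.tgt_face_zero_zero (η.2 k ((p.face 0).face 0)))),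
   0)

/-- The structure operator of the adjoint representation, `D = R_0 ⋆ + D̂_λ + R_2 ⋆`. -/
def adOp (c : 𝒢.Connection) (η : 𝒢.RawCochain) : 𝒢.RawCochain :=
  anchorOp η + quasiOp c η + curvOp c η

/-- `R` is the adjoint representation `Ad_σ(G)`: its structure operator is the one with components
`R_0 = ρ`, `R_1 = λ`, `R_2 = K`. -/
def AdRep.IsAdjoint (R : 𝒢.AdRep) (c : 𝒢.Connection) : Prop :=
  ∀ η : 𝒢.AdCochain, (R.D η : 𝒢.RawCochain) = adOp c η.1

/-- The operator `η ↦ Ψ_1 ⋆ η` for `Ψ_1 = σ - σ' : TM → A`, that is,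
`(Ψ_1 ⋆ η)(g_1, …, g_{k+1}) = (-1)^{k+1} Ψ_1(g_1) η(g_2, …, g_{k+1})` for `η` of bidegree
`(k, 1)`. -/
def psi1Op (c c' : 𝒢.Connection) (η : 𝒢.RawCochain) : 𝒢.RawCochain :=
  (fun n => match n with
    | 0 => fun _ => 0
    | k + 1 => fun p => (-1 : ℝ) ^ (k + 1) •
        tcast (congrArg 𝒢.one p.t_arr_zero)
          (Connection.psi1 c c' (p.arr 0) (tcast p.tgt_face_zero (η.2 k (p.face 0)))),
   0)

end Operators

end LieGroupoid

end

/-! Write a cochain as a pair (a, b) with components in A and TM. Up to signs the structure operator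
is a 2 × 2 matrix: the operators `dhat` of the two quasi-actions on the diagonal, ρ and K off it. So
D² = 0 follows from four pointwise identities: ρ intertwines the quasi-actions (`anchorL_lamAL`);
the defect λ_g λ_h − λ_{gh} is K(g,h)ρ on A (`KL_anchorL`) and ρK(g,h) on TM (`anchorL_KL`); K
satisfies a cocycle equation (`KL_cocycle`). In the same way 1 + Ψ₁ intertwines D_σ and D_σ' because
Ψ₁ρ and ρΨ₁ are the differences of the quasi-actions on A and TM (`psiL_anchorL`, `anchorL_psiL`)
and the twisted coboundary of Ψ₁ is K_σ − K_σ' (`psiL_cocycle`). Since Ψ₁ goes from TM to A, Ψ₁² =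
0, and 1 − Ψ₁ is the inverse.

The pointwise identities hold because TG is a groupoid over TM with multiplication dm. Right
translation embeds A_{t(g)} in T_gG, and there r_g λ_g α = σ_g ρα − l_g α, while r_{gh} K(g,h)X =
dm(σ_g λ_h X, σ_h X) − σ_{gh}X. What remains is linearity and associativity of dm (`mulL_assoc`) and
dm(l_g α, r_h α) = 0 (`mulL_lTransL_rTransL`). The tangent groupoid laws are obtained by
differentiating the groupoid laws along curves of composable arrows, which exist with any admissible
velocities because t is a submersion.

Passing from pointwise identities to operators is simplicial bookkeeping: `dhat_dhat`, `dhat_shift₂`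
and `dhat_shift_add_shift_dhat` cancel all terms but those where λ, K or Ψ₁ meets g_1, g_2 or g_3.
The Leibniz rule is `sgn_dhat_starFam`. Finally the operators must preserve smooth sections, which
reduces to smoothness of dm along families (`SmoothAlong.groupoid_mul`). -/

noncomputable section

open Filter Topology

/-! ### Local sections of submersions -/

section Submersion

variable {EX : Type*} [NormedAddCommGroup EX] [NormedSpace ℝ EX]
  {EY : Type*} [NormedAddCommGroup EY] [NormedSpace ℝ EY]
  {X : Type*} [TopologicalSpace X] [ChartedSpace EX X]
  {Y : Type*} [TopologicalSpace Y] [ChartedSpace EY Y]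

/-- Near a point of the source, a submersion `f` admits a smooth family of local right inverses
`y ↦ B (y, x)` such that `B (f x, x) = x`. -/
theorem Manifold.IsSubmersion.exists_section_family {f : X → Y}
    (hf : Manifold.IsSubmersion 𝓘(ℝ, EX) 𝓘(ℝ, EY) ∞ f) (x₀ : X) :
    ∃ B : Y × X → X,
      ContMDiffAt (𝓘(ℝ, EY).prod 𝓘(ℝ, EX)) 𝓘(ℝ, EX) ∞ B (f x₀, x₀) ∧
      (∀ᶠ p in 𝓝 (f x₀, x₀), f (B p) = p.1) ∧ (∀ᶠ x in 𝓝 x₀, B (f x, x) = x) ∧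
      B (f x₀, x₀) = x₀ := by
  obtain ⟨F, _, _, hF⟩ := hf
  have h := hF x₀
  set φ := h.domChart
  set ψ := h.codChart
  set e := h.equiv
  have hφ : x₀ ∈ φ.source := h.mem_domChart_source
  have hψ : f x₀ ∈ ψ.source := h.mem_codChart_source
  have hmaps := h.mapsto_domChart_source_codChart_source
  -- In the submersion charts f is the first projection. The right inverse therefore takes the base
  -- coordinate from y and keeps the fibre coordinate of x.
  have hw : ∀ z ∈ φ.target, ψ (f (φ.symm z)) = (e z).1 := fun z hz => by
    have hz' : z ∈ (φ.extend 𝓘(ℝ, EX)).target := by simpa [mfld_simps] using hz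
    simpa [mfld_simps] using h.writtenInCharts hz'
  have hB : ∀ x ∈ φ.source, φ.symm (e.symm (ψ (f x), (e (φ x)).2)) = x := fun x hx => by
    have h1 := hw (φ x) (φ.map_source hx)
    rw [φ.left_inv hx] at h1
    rw [h1, Prod.mk.eta, e.symm_apply_apply, φ.left_inv hx]
  have hsmooth : ContMDiffAt (𝓘(ℝ, EY).prod 𝓘(ℝ, EX)) 𝓘(ℝ, EX) ∞
      (fun p : Y × X => e.symm (ψ p.1, (e (φ p.2)).2)) (f x₀, x₀) := by
    have h1 : ContMDiffAt (𝓘(ℝ, EY).prod 𝓘(ℝ, EX)) 𝓘(ℝ, EY) ∞ (fun p : Y × X => ψ p.1)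
        (f x₀, x₀) :=
      ((contMDiffOn_of_mem_maximalAtlas h.codChart_mem_maximalAtlas).contMDiffAt
        (ψ.open_source.mem_nhds hψ)).comp (f x₀, x₀) contMDiffAt_fst
    have h2 : ContMDiffAt (𝓘(ℝ, EY).prod 𝓘(ℝ, EX)) 𝓘(ℝ, EX) ∞ (fun p : Y × X => φ p.2)
        (f x₀, x₀) :=
      ContMDiffAt.comp (f x₀, x₀) (g := φ)
        ((contMDiffOn_of_mem_maximalAtlas h.domChart_mem_maximalAtlas).contMDiffAt
        (φ.open_source.mem_nhds hφ)) contMDiffAt_snd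
    have h3 : ContMDiffAt (𝓘(ℝ, EY).prod 𝓘(ℝ, EX)) 𝓘(ℝ, F) ∞ (fun p : Y × X => (e (φ p.2)).2)
        (f x₀, x₀) :=
      (((ContinuousLinearMap.snd ℝ EY F).comp (e : EX →L[ℝ] EY × F)).contMDiff.contMDiffAt
        (n := ∞)).comp (f x₀, x₀) h2
    exact ((e.symm : EY × F →L[ℝ] EX).contMDiff.contMDiffAt (n := ∞)).comp (f x₀, x₀)
      (h1.prodMk_space h3)
  have h0 : e.symm (ψ (f x₀), (e (φ x₀)).2) = φ x₀ := by
    have := hB x₀ hφ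
    have h1 := hw (φ x₀) (φ.map_source hφ)
    rw [φ.left_inv hφ] at h1
    rw [h1, Prod.mk.eta, e.symm_apply_apply]
  refine ⟨fun p => φ.symm (e.symm (ψ p.1, (e (φ p.2)).2)), ?_, ?_, ?_, hB x₀ hφ⟩
  · refine ContMDiffAt.comp (f x₀, x₀) (g := φ.symm) ?_ hsmooth
    rw [h0]
    exact (contMDiffOn_symm_of_mem_maximalAtlas h.domChart_mem_maximalAtlas).contMDiffAt
        (φ.open_target.mem_nhds (φ.map_source hφ))
  · have h1 : ∀ᶠ p in 𝓝 (f x₀, x₀), e.symm (ψ p.1, (e (φ p.2)).2) ∈ φ.target := by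
      refine hsmooth.continuousAt.eventually_mem (φ.open_target.mem_nhds ?_)
      simpa only [h0] using φ.map_source hφ
    have h2 : ∀ᶠ p in 𝓝 (f x₀, x₀), p.1 ∈ ψ.source :=
      continuousAt_fst.eventually_mem (ψ.open_source.mem_nhds hψ)
    filter_upwards [h1, h2] with p hp1 hp2
    refine ψ.injOn (hmaps (φ.map_target hp1)) hp2 ?_
    rw [hw _ hp1, e.apply_symm_apply]
  · filter_upwards [φ.open_source.mem_nhds hφ] with x hx using hB x hx

end Submersion

/-! ### Calculus with velocities of curves -/

section Velocity

variable {E : Type*} [NormedAddCommGroup E] [NormedSpace ℝ E]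
  {X : Type*} [TopologicalSpace X] [ChartedSpace E X]
  {E' : Type*} [NormedAddCommGroup E'] [NormedSpace ℝ E']
  {Y : Type*} [TopologicalSpace Y] [ChartedSpace E' Y]

/-- The curve `γ` passes through `x` at time `0` with velocity `v`. -/
def HasVelocity (γ : ℝ → X) (x : X) (v : E) : Prop :=
  γ 0 = x ∧ HasMFDerivAt 𝓘(ℝ, ℝ) 𝓘(ℝ, E) γ 0 (ContinuousLinearMap.toSpanSingleton ℝ v : ℝ →L[ℝ] E)

theorem HasVelocity.continuousAt {γ : ℝ → X} {x : X} {v : E} (h : HasVelocity γ x v) :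
    Tendsto γ (𝓝 0) (𝓝 x) := by
  have := h.2.continuousAt
  rwa [ContinuousAt, h.1] at this

theorem HasVelocity.comp {γ : ℝ → X} {x : X} {v : E} (h : HasVelocity γ x v) {f : X → Y}
    {f' : E →L[ℝ] E'} (hf : HasMFDerivAt 𝓘(ℝ, E) 𝓘(ℝ, E') f x f') :
    HasVelocity (fun τ => f (γ τ)) (f x) (f' v) := by
  obtain ⟨rfl, h⟩ := h
  refine ⟨rfl, ?_⟩
  have he : (ContinuousLinearMap.toSpanSingleton ℝ (f' v) : ℝ →L[ℝ] E') =
      f'.comp (ContinuousLinearMap.toSpanSingleton ℝ v) := by ext; simp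
  rw [he]
  exact HasMFDerivAt.comp 0 hf h

/-- The device that turns an identity between curves near time 0 into an identity between tangent
vectors. -/
theorem HasVelocity.unique {γ γ' : ℝ → X} {x : X} {v v' : E} (h : HasVelocity γ x v)
    (h' : HasVelocity γ' x v') (he : γ =ᶠ[𝓝 0] γ') : v = v' := by
  have h1 := hasMFDerivAt_unique (h.2.congr_of_eventuallyEq he.symm) h'.2
  have h2 := congrArg (fun L : ℝ →L[ℝ] E => L 1) h1
  simpa using h2

/-- Take the straight line in the preferred chart at `x`; tangent vectors at `x` are by definition
coordinates in that chart. -/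
theorem exists_hasVelocity (x : X) (v : E) : ∃ γ : ℝ → X, HasVelocity γ x v := by
  have h0 : (chartAt E x).symm (chartAt E x x + (0 : ℝ) • v) = x := by
    simp
  have hc : Continuous fun τ : ℝ => chartAt E x x + τ • v := by fun_prop
  have hmem : ∀ᶠ τ : ℝ in 𝓝 0, chartAt E x x + τ • v ∈ (chartAt E x).target := by
    refine hc.continuousAt.eventually_mem ((chartAt E x).open_target.mem_nhds ?_)
    simp
  refine ⟨fun τ => (chartAt E x).symm (chartAt E x x + τ • v), h0, ?_, ?_⟩
  · refine ContinuousAt.comp (g := (chartAt E x).symm) ?_ hc.continuousAt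
    refine (chartAt E x).continuousAt_symm ?_
    simp
  · have hd : HasFDerivAt (fun τ : ℝ => chartAt E x x + τ • v)
        (ContinuousLinearMap.toSpanSingleton ℝ v) 0 := by
      have := (ContinuousLinearMap.toSpanSingleton ℝ v).hasFDerivAt (x := (0 : ℝ))
      simpa using this.const_add (chartAt E x x)
    simp only [writtenInExtChartAt, mfld_simps, Set.range_id]
    refine (hd.congr_of_eventuallyEq ?_).hasFDerivWithinAt
    filter_upwards [hmem] with τ hτ
    simp only [h0, mfld_simps]
    exact (chartAt E x).right_inv hτ

theorem HasVelocity.prodMk {γ : ℝ → X} {x : X} {v : E} (h : HasVelocity γ x v) {γ' : ℝ → Y} {y : Y}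
    {v' : E'} (h' : HasVelocity γ' y v') :
    HasMFDerivAt 𝓘(ℝ, ℝ) (𝓘(ℝ, E).prod 𝓘(ℝ, E')) (fun τ => (γ τ, γ' τ)) 0
      (ContinuousLinearMap.toSpanSingleton ℝ (v, v') : ℝ →L[ℝ] E × E') := by
  have := h.2.prodMk h'.2
  convert! this using 1

/-- Meant for the groupoid multiplication, which is differentiable only within the set of composable
pairs: a curve of pairs that stays in `S` for small times still has an honest velocity after
composition. -/
theorem HasVelocity.comp₂ {E'' : Type*} [NormedAddCommGroup E''] [NormedSpace ℝ E'']
    {Z : Type*} [TopologicalSpace Z] [ChartedSpace E'' Z] {γ : ℝ → X} {x : X} {v : E}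
    (h : HasVelocity γ x v) {γ' : ℝ → Y} {y : Y} {v' : E'} (h' : HasVelocity γ' y v')
    {f : X × Y → Z} {f' : E × E' →L[ℝ] E''} {S : Set (X × Y)}
    (hf : HasMFDerivWithinAt (𝓘(ℝ, E).prod 𝓘(ℝ, E')) 𝓘(ℝ, E'') f S (x, y) f')
    (hS : ∀ᶠ τ in 𝓝 0, (γ τ, γ' τ) ∈ S) :
    HasVelocity (fun τ => f (γ τ, γ' τ)) (f (x, y)) (f' (v, v')) := by
  have hp := h.prodMk h'
  obtain ⟨rfl, h⟩ := h
  obtain ⟨rfl, h'⟩ := h'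
  refine ⟨rfl, ?_⟩
  have := HasMFDerivWithinAt.comp (s := {τ | (γ τ, γ' τ) ∈ S}) (0 : ℝ) hf hp.hasMFDerivWithinAt
    (fun τ hτ => hτ)
  have he : (ContinuousLinearMap.toSpanSingleton ℝ (f' (v, v')) : ℝ →L[ℝ] E'') =
      f'.comp (ContinuousLinearMap.toSpanSingleton ℝ (v, v')) := by ext; simp
  rw [he]
  exact this.hasMFDerivAt hS

end Velocity

/-! ### Smoothness of tangent maps -/

section TangentMap

variable {E : Type*} [NormedAddCommGroup E] [NormedSpace ℝ E]
  {H : Type*} [TopologicalSpace H] {I : ModelWithCorners ℝ E H}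
  {X : Type*} [TopologicalSpace X] [ChartedSpace H X] [IsManifold I ∞ X]
  {E' : Type*} [NormedAddCommGroup E'] [NormedSpace ℝ E']
  {H' : Type*} [TopologicalSpace H'] {I' : ModelWithCorners ℝ E' H'}
  {Y : Type*} [TopologicalSpace Y] [ChartedSpace H' Y] [IsManifold I' ∞ Y]

/-- A pointwise form is needed because the local extensions of the multiplication are only known to
be smooth at one given point. -/
theorem ContMDiffAt.contMDiffAt_tangentMap {f : X → Y} {w₀ : TangentBundle I X}
    (hf : ContMDiffAt I I' ∞ f w₀.1) :
    ContMDiffAt I.tangent I'.tangent ∞ (tangentMap I I' f) w₀ := by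
  have : IsManifold I 1 X := IsManifold.of_le (n := ∞) (by simp)
  have : IsManifold I' 1 Y := IsManifold.of_le (n := ∞) (by simp)
  let b₁ : TangentBundle I X → X := fun p => p.1
  let v : ∀ y : TangentBundle I X, TangentSpace I (b₁ y) := fun y => y.2
  have hv : ContMDiffWithinAt I.tangent I.tangent ∞
      (fun y => (⟨b₁ y, v y⟩ : TangentBundle I X)) Set.univ w₀ := contMDiffWithinAt_id
  have hb₁ : ContMDiffAt I.tangent I ∞ b₁ w₀ := Bundle.contMDiffAt_proj (TangentSpace I)
  let b₂ : TangentBundle I X → Y := f ∘ b₁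
  have hb₂ : ContMDiffAt I.tangent I' ∞ b₂ w₀ := ContMDiffAt.comp w₀ hf hb₁
  have A := (hf.mfderiv_const (m := ∞) (by simp)).comp w₀ hb₁
  exact ContMDiffWithinAt.clm_apply_of_inCoordinates
    (ϕ := fun y => mfderiv I I' f (b₁ y)) A.contMDiffWithinAt hv hb₂.contMDiffWithinAt

end TangentMap

/-! ### Smooth families of tangent vectors -/

section SmoothAlong

variable {E : Type*} [NormedAddCommGroup E] [NormedSpace ℝ E]
  {X : Type*} [TopologicalSpace X] [ChartedSpace E X] [IsManifold 𝓘(ℝ, E) ∞ X]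
  {E' : Type*} [NormedAddCommGroup E'] [NormedSpace ℝ E']
  {Y : Type*} [TopologicalSpace Y] [ChartedSpace E' Y] [IsManifold 𝓘(ℝ, E') ∞ Y]
  {d : ℕ}

/-- The vectors are typed in the model space, so base points can be replaced by equal ones without
any transport. -/
theorem SmoothAlong.congr {c c' : EuclideanSpace ℝ (Fin d) → X}
    {v v' : EuclideanSpace ℝ (Fin d) → E} (h : SmoothAlong c v) (hc : ∀ u, c' u = c u)
    (hv : ∀ u, v' u = v u) : SmoothAlong c' v' := by
  obtain rfl : c' = c := funext hc
  obtain rfl : v' = v := funext hv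
  exact h

theorem SmoothAlong.map {c : EuclideanSpace ℝ (Fin d) → X} {v : EuclideanSpace ℝ (Fin d) → E}
    (hv : SmoothAlong c v) {f : X → Y} (hf : ContMDiff 𝓘(ℝ, E) 𝓘(ℝ, E') ∞ f) :
    SmoothAlong (fun u => f (c u)) (fun u => mfderiv 𝓘(ℝ, E) 𝓘(ℝ, E') f (c u) (v u)) :=
  fun u => (ContMDiffAt.contMDiffAt_tangentMap
    (w₀ := (⟨c u, v u⟩ : TangentBundle 𝓘(ℝ, E) X)) (hf (c u))).comp u (hv u)

theorem SmoothAlong.neg {c : EuclideanSpace ℝ (Fin d) → X} {v : EuclideanSpace ℝ (Fin d) → E}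
    (hv : SmoothAlong c v) : SmoothAlong c (fun u => - v u) :=
  (SmoothAlong.smul (f := fun _ => (-1 : ℝ)) contMDiff_const hv).congr (fun _ => rfl)
    (fun u => (neg_one_smul ℝ (v u)).symm)

end SmoothAlong

/-! ### Tangent vectors as elements of the model space -/

section Untyped

variable {E : Type*} [NormedAddCommGroup E] [NormedSpace ℝ E]
  {X : Type*} [TopologicalSpace X] [ChartedSpace E X]

/-- Every tangent space is definitionally the model space, and transport is the identity there. This
is what allows all later identities to be computed with linear maps between the fixed spaces `EM`
and `EG`. -/
theorem tcast_eq {x y : X} (h : x = y) (v : E) : (tcast h v : E) = v := by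
  subst h; rfl

end Untyped

namespace LieGroupoid

variable {EM : Type u₁} [NormedAddCommGroup EM] [NormedSpace ℝ EM]
  {EG : Type u₂} [NormedAddCommGroup EG] [NormedSpace ℝ EG]
  {M : Type u₃} [TopologicalSpace M] [ChartedSpace EM M]
  {G : Type u₄} [TopologicalSpace G] [ChartedSpace EG G]
  (𝒢 : LieGroupoid EM EG M G)

/-! ### The tangent groupoid -/

/-- The differential of the source, as a map of model spaces. -/
def sL (g : G) : EG →L[ℝ] EM := 𝒢.ds g

/-- The differential of the target, as a map of model spaces. -/
def tL (g : G) : EG →L[ℝ] EM := 𝒢.dt g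

/-- The differential of the unit map, as a map of model spaces. -/
def oneL (x : M) : EM →L[ℝ] EG := mfderiv 𝓘(ℝ, EM) 𝓘(ℝ, EG) 𝒢.one x

/-- The differential of the inversion, as a map of model spaces. -/
def invL (g : G) : EG →L[ℝ] EG := mfderiv 𝓘(ℝ, EG) 𝓘(ℝ, EG) 𝒢.inv g

/-- The differential of the multiplication, as a map of model spaces. -/
def mulL (g h : G) : EG × EG →L[ℝ] EG :=
  mfderivWithin (𝓘(ℝ, EG).prod 𝓘(ℝ, EG)) 𝓘(ℝ, EG) (fun p : G × G => 𝒢.mul p.1 p.2)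
    {p : G × G | 𝒢.s p.1 = 𝒢.t p.2} (g, h)

theorem s_smooth : ContMDiff 𝓘(ℝ, EG) 𝓘(ℝ, EM) ∞ 𝒢.s := 𝒢.s_submersion.contMDiff

theorem t_smooth : ContMDiff 𝓘(ℝ, EG) 𝓘(ℝ, EM) ∞ 𝒢.t := 𝒢.t_submersion.contMDiff

theorem hasMFDerivAt_s (g : G) : HasMFDerivAt 𝓘(ℝ, EG) 𝓘(ℝ, EM) 𝒢.s g (𝒢.sL g) :=
  (𝒢.s_smooth.mdifferentiable (by simp) g).hasMFDerivAt

theorem hasMFDerivAt_t (g : G) : HasMFDerivAt 𝓘(ℝ, EG) 𝓘(ℝ, EM) 𝒢.t g (𝒢.tL g) :=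
  (𝒢.t_smooth.mdifferentiable (by simp) g).hasMFDerivAt

theorem hasMFDerivAt_one (x : M) : HasMFDerivAt 𝓘(ℝ, EM) 𝓘(ℝ, EG) 𝒢.one x (𝒢.oneL x) :=
  (𝒢.one_smooth.mdifferentiable (by simp) x).hasMFDerivAt

theorem hasMFDerivAt_inv (g : G) : HasMFDerivAt 𝓘(ℝ, EG) 𝓘(ℝ, EG) 𝒢.inv g (𝒢.invL g) :=
  (𝒢.inv_smooth.mdifferentiable (by simp) g).hasMFDerivAt

theorem hasMFDerivWithinAt_mul {g h : G} (hc : 𝒢.s g = 𝒢.t h) :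
    HasMFDerivWithinAt (𝓘(ℝ, EG).prod 𝓘(ℝ, EG)) 𝓘(ℝ, EG) (fun p : G × G => 𝒢.mul p.1 p.2)
      {p : G × G | 𝒢.s p.1 = 𝒢.t p.2} (g, h) (𝒢.mulL g h) :=
  (𝒢.mul_smooth.mdifferentiableOn (by simp) (g, h) hc).hasMFDerivWithinAt

variable {𝒢}

theorem _root_.HasVelocity.groupoid_mul {a b : ℝ → G} {g h : G} {u v : EG}
    (ha : HasVelocity a g u) (hb : HasVelocity b h v) (hc : 𝒢.s g = 𝒢.t h)
    (hab : ∀ᶠ τ in 𝓝 0, 𝒢.s (a τ) = 𝒢.t (b τ)) :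
    HasVelocity (fun τ => 𝒢.mul (a τ) (b τ)) (𝒢.mul g h) (𝒢.mulL g h (u, v)) :=
  ha.comp₂ hb (𝒢.hasMFDerivWithinAt_mul hc) hab

/-- A curve in `G` lifts to a curve of composable pairs with a prescribed velocity. -/
theorem _root_.HasVelocity.exists_composable {a : ℝ → G} {g h : G} {u v : EG}
    (ha : HasVelocity a g u) (hc : 𝒢.s g = 𝒢.t h) (huv : 𝒢.sL g u = 𝒢.tL h v) :
    ∃ b, HasVelocity b h v ∧ ∀ᶠ τ in 𝓝 0, 𝒢.s (a τ) = 𝒢.t (b τ) := by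
  obtain ⟨B, hB, hB1, hB2, hB3⟩ := 𝒢.t_submersion.exists_section_family h
  obtain ⟨β, hβ⟩ := exists_hasVelocity h v
  have hBd := (hB.mdifferentiableAt (by simp)).hasMFDerivAt
  have hsa := ha.comp (𝒢.hasMFDerivAt_s g)
  have htβ := hβ.comp (𝒢.hasMFDerivAt_t h)
  rw [hc] at hsa
  have h1 := htβ.comp₂ hβ hBd.hasMFDerivWithinAt (S := Set.univ) (by simp)
  have h2 := hsa.comp₂ hβ hBd.hasMFDerivWithinAt (S := Set.univ) (by simp)
  rw [hB3] at h1 h2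
  -- As B (t x, x) = x near h, the vector dB(dt v, v) is v. Since ds u = dt v, the curve τ ↦ B (s (a
  -- τ), β τ) has the same velocity.
  have h3 := h1.unique hβ (hβ.continuousAt.eventually hB2)
  rw [huv, h3] at h2
  refine ⟨_, h2, ?_⟩
  have h4 : Tendsto (fun τ => (𝒢.s (a τ), β τ)) (𝓝 0) (𝓝 (𝒢.t h, h)) :=
    hsa.continuousAt.prodMk_nhds hβ.continuousAt
  filter_upwards [h4.eventually hB1] with τ hτ using hτ.symm

theorem exists_composable_curves {g h : G} {u v : EG} (hc : 𝒢.s g = 𝒢.t h)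
    (huv : 𝒢.sL g u = 𝒢.tL h v) :
    ∃ a b, HasVelocity a g u ∧ HasVelocity b h v ∧ ∀ᶠ τ in 𝓝 0, 𝒢.s (a τ) = 𝒢.t (b τ) := by
  obtain ⟨a, ha⟩ := exists_hasVelocity g u
  obtain ⟨b, hb, hab⟩ := ha.exists_composable hc huv
  exact ⟨a, b, ha, hb, hab⟩

/-- Differentiate s(ab) = s(b) along composable curves. The other laws of the tangent groupoid come
from the corresponding groupoid laws in the same manner. -/
theorem sL_mulL {g h : G} {u v : EG} (hc : 𝒢.s g = 𝒢.t h) (huv : 𝒢.sL g u = 𝒢.tL h v) :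
    𝒢.sL (𝒢.mul g h) (𝒢.mulL g h (u, v)) = 𝒢.sL h v := by
  obtain ⟨a, b, ha, hb, hab⟩ := exists_composable_curves hc huv
  have h1 := (ha.groupoid_mul hb hc hab).comp (𝒢.hasMFDerivAt_s _)
  rw [𝒢.s_mul g h hc] at h1
  refine h1.unique (hb.comp (𝒢.hasMFDerivAt_s _)) ?_
  filter_upwards [hab] with τ hτ using 𝒢.s_mul _ _ hτ

theorem tL_mulL {g h : G} {u v : EG} (hc : 𝒢.s g = 𝒢.t h) (huv : 𝒢.sL g u = 𝒢.tL h v) :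
    𝒢.tL (𝒢.mul g h) (𝒢.mulL g h (u, v)) = 𝒢.tL g u := by
  obtain ⟨a, b, ha, hb, hab⟩ := exists_composable_curves hc huv
  have h1 := (ha.groupoid_mul hb hc hab).comp (𝒢.hasMFDerivAt_t _)
  rw [𝒢.t_mul g h hc] at h1
  refine h1.unique (ha.comp (𝒢.hasMFDerivAt_t _)) ?_
  filter_upwards [hab] with τ hτ using 𝒢.t_mul _ _ hτ

/-- A curve through `g` is lifted to one through `h` composable with it, and that one to a curve
through `k`; associativity of the three curves is then differentiated. -/
theorem mulL_assoc {g h k : G} {u v w : EG} (hgh : 𝒢.s g = 𝒢.t h) (hhk : 𝒢.s h = 𝒢.t k)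
    (huv : 𝒢.sL g u = 𝒢.tL h v) (hvw : 𝒢.sL h v = 𝒢.tL k w) :
    𝒢.mulL (𝒢.mul g h) k (𝒢.mulL g h (u, v), w) =
      𝒢.mulL g (𝒢.mul h k) (u, 𝒢.mulL h k (v, w)) := by
  obtain ⟨a, b, ha, hb, hab⟩ := exists_composable_curves hgh huv
  obtain ⟨c, hc, hbc⟩ := hb.exists_composable hhk hvw
  have h1 := (ha.groupoid_mul hb hgh hab).groupoid_mul hc (by rw [𝒢.s_mul _ _ hgh, hhk])
    (by filter_upwards [hab, hbc] with τ h1 h2 using by rw [𝒢.s_mul _ _ h1, h2])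
  have h2 := ha.groupoid_mul (hb.groupoid_mul hc hhk hbc) (by rw [𝒢.t_mul _ _ hhk, hgh])
    (by filter_upwards [hab, hbc] with τ h1 h2 using by rw [𝒢.t_mul _ _ h2, h1])
  rw [𝒢.mul_assoc _ _ _ hgh hhk] at h1
  refine h1.unique h2 ?_
  filter_upwards [hab, hbc] with τ h1 h2 using 𝒢.mul_assoc _ _ _ h1 h2

theorem sL_invL (g : G) (u : EG) : 𝒢.sL (𝒢.inv g) (𝒢.invL g u) = 𝒢.tL g u := by
  obtain ⟨a, ha⟩ := exists_hasVelocity g u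
  have h1 := (ha.comp (𝒢.hasMFDerivAt_inv g)).comp (𝒢.hasMFDerivAt_s _)
  rw [𝒢.s_inv] at h1
  exact h1.unique (ha.comp (𝒢.hasMFDerivAt_t g)) (by simp [𝒢.s_inv, Filter.EventuallyEq])

theorem tL_invL (g : G) (u : EG) : 𝒢.tL (𝒢.inv g) (𝒢.invL g u) = 𝒢.sL g u := by
  obtain ⟨a, ha⟩ := exists_hasVelocity g u
  have h1 := (ha.comp (𝒢.hasMFDerivAt_inv g)).comp (𝒢.hasMFDerivAt_t _)
  rw [𝒢.t_inv] at h1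
  exact h1.unique (ha.comp (𝒢.hasMFDerivAt_s g)) (by simp [𝒢.t_inv, Filter.EventuallyEq])

theorem mulL_oneL (g : G) (u : EG) :
    𝒢.mulL g (𝒢.one (𝒢.s g)) (u, 𝒢.oneL (𝒢.s g) (𝒢.sL g u)) = u := by
  obtain ⟨a, ha⟩ := exists_hasVelocity g u
  have h1 := ha.groupoid_mul ((ha.comp (𝒢.hasMFDerivAt_s g)).comp (𝒢.hasMFDerivAt_one _))
    (𝒢.t_one _).symm (Eventually.of_forall fun τ => (𝒢.t_one _).symm)
  rw [𝒢.mul_one] at h1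
  exact h1.unique ha (by simp [𝒢.mul_one, Filter.EventuallyEq])

theorem invL_mulL (g : G) (u : EG) :
    𝒢.mulL (𝒢.inv g) g (𝒢.invL g u, u) = 𝒢.oneL (𝒢.s g) (𝒢.sL g u) := by
  obtain ⟨a, ha⟩ := exists_hasVelocity g u
  have h1 := (ha.comp (𝒢.hasMFDerivAt_inv g)).groupoid_mul ha
    (𝒢.s_inv _) (Eventually.of_forall fun τ => 𝒢.s_inv _)
  rw [𝒢.inv_mul] at h1
  exact h1.unique ((ha.comp (𝒢.hasMFDerivAt_s g)).comp (𝒢.hasMFDerivAt_one _))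
    (by simp [𝒢.inv_mul, Filter.EventuallyEq])

/-! ### Smoothness of the tangent multiplication -/

variable (𝒢) in
/-- The multiplication extends locally to a smooth map on `G × G`. -/
theorem exists_mul_extension {g₀ h₀ : G} (hc : 𝒢.s g₀ = 𝒢.t h₀) :
    ∃ m : G × G → G, ContMDiffAt (𝓘(ℝ, EG).prod 𝓘(ℝ, EG)) 𝓘(ℝ, EG) ∞ m (g₀, h₀) ∧
      ∀ᶠ p in 𝓝 (g₀, h₀), 𝒢.s p.1 = 𝒢.t p.2 → m p = 𝒢.mul p.1 p.2 := by
  obtain ⟨B, hB, hB1, hB2, hB3⟩ := 𝒢.t_submersion.exists_section_family h₀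
  have hk : ContMDiffAt (𝓘(ℝ, EG).prod 𝓘(ℝ, EG)) (𝓘(ℝ, EM).prod 𝓘(ℝ, EG)) ∞
      (fun p : G × G => (𝒢.s p.1, p.2)) (g₀, h₀) :=
    ((𝒢.s_smooth g₀).comp (g₀, h₀) contMDiffAt_fst).prodMk contMDiffAt_snd
  have hk' : Tendsto (fun p : G × G => (𝒢.s p.1, p.2)) (𝓝 (g₀, h₀)) (𝓝 (𝒢.t h₀, h₀)) := by
    have := hk.continuousAt
    rwa [ContinuousAt, hc] at this
  have hq : ContMDiffAt (𝓘(ℝ, EG).prod 𝓘(ℝ, EG)) (𝓘(ℝ, EG).prod 𝓘(ℝ, EG)) ∞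
      (fun p : G × G => (p.1, B (𝒢.s p.1, p.2))) (g₀, h₀) :=
    contMDiffAt_fst.prodMk (hB.comp_of_eq hk (by simp [hc]))
  -- B moves the second arrow to one that is composable with the first, and leaves it fixed when it
  -- already is.
  refine ⟨fun p => 𝒢.mul p.1 (B (𝒢.s p.1, p.2)), ?_, ?_⟩
  · have h1 : ContMDiffWithinAt (𝓘(ℝ, EG).prod 𝓘(ℝ, EG)) 𝓘(ℝ, EG) ∞
        (fun p : G × G => 𝒢.mul p.1 (B (𝒢.s p.1, p.2)))
        {p | 𝒢.s p.1 = 𝒢.t (B (𝒢.s p.1, p.2))} (g₀, h₀) := by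
      refine ContMDiffWithinAt.comp_of_eq (𝒢.mul_smooth (g₀, h₀) hc) hq.contMDiffWithinAt
        (fun p hp => hp) ?_
      simp [hc, hB3]
    refine h1.contMDiffAt ?_
    filter_upwards [hk'.eventually hB1] with p hp using hp.symm
  · have h2 : ∀ᶠ p : G × G in 𝓝 (g₀, h₀), B (𝒢.t p.2, p.2) = p.2 :=
      (continuous_snd.tendsto (g₀, h₀)).eventually hB2
    filter_upwards [h2] with p hp hp'
    rw [hp', hp]

/-- On vectors tangent to the composable pairs the differential of an extension is computed along
composable curves, where the extension is the multiplication itself. -/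
theorem mfderiv_eq_mulL {m : G × G → G} {g h : G} {u v : EG} (hc : 𝒢.s g = 𝒢.t h)
    (huv : 𝒢.sL g u = 𝒢.tL h v)
    (hm : MDifferentiableAt (𝓘(ℝ, EG).prod 𝓘(ℝ, EG)) 𝓘(ℝ, EG) m (g, h))
    (hm' : ∀ᶠ p in 𝓝 (g, h), 𝒢.s p.1 = 𝒢.t p.2 → m p = 𝒢.mul p.1 p.2) :
    (mfderiv (𝓘(ℝ, EG).prod 𝓘(ℝ, EG)) 𝓘(ℝ, EG) m (g, h) : EG × EG →L[ℝ] EG) (u, v) =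
      𝒢.mulL g h (u, v) := by
  obtain ⟨a, b, ha, hb, hab⟩ := exists_composable_curves hc huv
  have h1 := ha.comp₂ hb hm.hasMFDerivAt.hasMFDerivWithinAt (S := Set.univ) (by simp)
  rw [hm'.self_of_nhds hc] at h1
  refine h1.unique (ha.groupoid_mul hb hc hab) ?_
  filter_upwards [hab, (ha.continuousAt.prodMk_nhds hb.continuousAt).eventually hm']
    with τ h2 h3 using h3 h2

variable [IsManifold 𝓘(ℝ, EG) ∞ G]

/-- Near each parameter the family is the tangent map of a smooth local extension of the
multiplication, applied to a smooth family in T(G × G). -/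
theorem _root_.SmoothAlong.groupoid_mul {d : ℕ} {c e : EuclideanSpace ℝ (Fin d) → G}
    {v w : EuclideanSpace ℝ (Fin d) → EG} (hv : SmoothAlong c v) (hw : SmoothAlong e w)
    (hc : ∀ u, 𝒢.s (c u) = 𝒢.t (e u)) (hvw : ∀ u, 𝒢.sL (c u) (v u) = 𝒢.tL (e u) (w u)) :
    SmoothAlong (fun u => 𝒢.mul (c u) (e u)) (fun u => 𝒢.mulL (c u) (e u) (v u, w u)) := by
  have : IsManifold 𝓘(ℝ, EG) 1 G := IsManifold.of_le (n := ∞) (by simp)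
  intro u₀
  obtain ⟨m, hm, hm'⟩ := 𝒢.exists_mul_extension (hc u₀)
  have hpair : ContMDiffAt 𝓘(ℝ, EuclideanSpace ℝ (Fin d)) (𝓘(ℝ, EG).prod 𝓘(ℝ, EG)).tangent ∞
      (fun u => (⟨(c u, e u), (v u, w u)⟩ :
        TangentBundle (𝓘(ℝ, EG).prod 𝓘(ℝ, EG)) (G × G))) u₀ :=
    (contMDiff_equivTangentBundleProd_symm (n := ∞) _).comp u₀
      ((hv u₀).prodMk (hw u₀))
  have h1 := (ContMDiffAt.contMDiffAt_tangentMap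
    (w₀ := (⟨(c u₀, e u₀), (v u₀, w u₀)⟩ : TangentBundle (𝓘(ℝ, EG).prod 𝓘(ℝ, EG)) (G × G)))
    hm).comp u₀ hpair
  refine h1.congr_of_eventuallyEq ?_
  have hcont : Tendsto (fun u => (c u, e u)) (𝓝 u₀) (𝓝 (c u₀, e u₀)) :=
    (hv.smooth_base.continuous.prodMk hw.smooth_base.continuous).continuousAt
  -- Smoothness of order ∞ at a point spreads to a neighbourhood only for each finite order; order 1
  -- is enough for differentiability.
  have hm1 : ∀ᶠ p in 𝓝 (c u₀, e u₀), MDifferentiableAt (𝓘(ℝ, EG).prod 𝓘(ℝ, EG)) 𝓘(ℝ, EG) m p := by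
    filter_upwards [(contMDiffAt_iff_contMDiffAt_nhds (by simp)).1 (hm.of_le (m := 1) (by simp))]
      with p hp using hp.mdifferentiableAt (by simp)
  filter_upwards [hcont.eventually hm1, hcont.eventually hm'.eventually_nhds] with u h2 h3
  have h4 := mfderiv_eq_mulL (hc u) (hvw u) h2 h3
  have h5 := h3.self_of_nhds (hc u)
  simp only [Function.comp_apply, tangentMap]
  exact Bundle.TotalSpace.ext h5.symm (heq_of_eq h4.symm)

end LieGroupoid

namespace LieGroupoid

variable {EM : Type u₁} [NormedAddCommGroup EM] [NormedSpace ℝ EM]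
  {EG : Type u₂} [NormedAddCommGroup EG] [NormedSpace ℝ EG]
  {M : Type u₃} [TopologicalSpace M] [ChartedSpace EM M]
  {G : Type u₄} [TopologicalSpace G] [ChartedSpace EG G]
  (𝒢 : LieGroupoid EM EG M G)

/-! ### Translations -/

/-- The anchor, as a map of model spaces. -/
def anchorL (x : M) : EG →L[ℝ] EM := 𝒢.tL (𝒢.one x)

/-- Right translation `A_{t g} → Ker (ds)_g`. -/
def rTransL (g : G) : EG →L[ℝ] EG :=
  (𝒢.mulL (𝒢.one (𝒢.t g)) g).comp (ContinuousLinearMap.inl ℝ EG EG)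

/-- The inverse of right translation, as a map of model spaces. -/
def rInvL (g : G) : EG →L[ℝ] EG :=
  (𝒢.mulL g (𝒢.inv g)).comp (ContinuousLinearMap.inl ℝ EG EG)

/-- Left translation, as a map of model spaces. -/
def lTransL (g : G) : EG →L[ℝ] EG :=
  (𝒢.mulL g (𝒢.one (𝒢.s g))).comp
    ((ContinuousLinearMap.inr ℝ EG EG).comp (𝒢.invL (𝒢.one (𝒢.s g))))

variable {𝒢}

theorem rTransL_apply (g : G) (a : EG) :
    𝒢.rTransL g a = 𝒢.mulL (𝒢.one (𝒢.t g)) g (a, 0) := rfl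

theorem lTransL_apply (g : G) (a : EG) :
    𝒢.lTransL g a = 𝒢.mulL g (𝒢.one (𝒢.s g)) (0, 𝒢.invL (𝒢.one (𝒢.s g)) a) := rfl

/-- The two halves need not be tangent to the composable pairs, so each depends on the derivative
chosen by `mfderivWithin`. The splitting is still valid, since that choice is a linear map on all of
`EG × EG`. -/
theorem mulL_eq_add (g h : G) (u v : EG) :
    𝒢.mulL g h (u, v) = 𝒢.mulL g h (u, 0) + 𝒢.mulL g h (0, v) := by
  rw [← map_add]; simp

theorem mulL_zero_zero (g h : G) : 𝒢.mulL g h (0, 0) = 0 := map_zero _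

theorem mulL_one_zero (g : G) {u : EG} (hu : 𝒢.sL g u = 0) :
    𝒢.mulL g (𝒢.one (𝒢.s g)) (u, 0) = u := by
  simpa [hu] using 𝒢.mulL_oneL g u

theorem sL_rInvL {g : G} {W : EG} (hW : 𝒢.sL g W = 0) :
    𝒢.sL (𝒢.one (𝒢.t g)) (𝒢.rInvL g W) = 0 := by
  have h := 𝒢.sL_mulL (u := W) (v := 0) (𝒢.t_inv g).symm (by simp [hW])
  rw [𝒢.mul_inv, map_zero] at h
  exact h

theorem tL_rTransL {g : G} {a : EG} (ha : 𝒢.sL (𝒢.one (𝒢.t g)) a = 0) :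
    𝒢.tL g (𝒢.rTransL g a) = 𝒢.anchorL (𝒢.t g) a := by
  have h := 𝒢.tL_mulL (u := a) (v := 0) (𝒢.s_one (𝒢.t g)) (by simp [ha])
  rw [𝒢.one_mul] at h
  exact h

/-- The differential of (x g⁻¹) g = x: associativity with zero vectors over g⁻¹ and g. -/
theorem rTransL_rInvL {g : G} {W : EG} (hW : 𝒢.sL g W = 0) :
    𝒢.rTransL g (𝒢.rInvL g W) = W := by
  have h := 𝒢.mulL_assoc (u := W) (v := 0) (w := 0) (𝒢.t_inv g).symm (𝒢.s_inv g) (by simp [hW])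
    (by simp)
  rw [𝒢.mul_inv, 𝒢.inv_mul, mulL_zero_zero, mulL_one_zero g hW] at h
  exact h

theorem rInvL_rTransL {g : G} {a : EG} (ha : 𝒢.sL (𝒢.one (𝒢.t g)) a = 0) :
    𝒢.rInvL g (𝒢.rTransL g a) = a := by
  have h := 𝒢.mulL_assoc (u := a) (v := 0) (w := 0) (𝒢.s_one (𝒢.t g)) (𝒢.t_inv g).symm
    (by simp [ha]) (by simp)
  have h2 := mulL_one_zero _ ha
  rw [𝒢.s_one] at h2
  rw [𝒢.mul_inv, 𝒢.one_mul, mulL_zero_zero, h2] at h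
  exact h

/-- Identities in A are proved below by right translating them to T_gG, where λ, K and Ψ₁ have
explicit expressions. -/
theorem rTransL_injective {g : G} {a b : EG} (ha : 𝒢.sL (𝒢.one (𝒢.t g)) a = 0)
    (hb : 𝒢.sL (𝒢.one (𝒢.t g)) b = 0) (h : 𝒢.rTransL g a = 𝒢.rTransL g b) : a = b := by
  rw [← rInvL_rTransL ha, h, rInvL_rTransL hb]

theorem rTransL_mul {g h : G} {a : EG} (hc : 𝒢.s g = 𝒢.t h)
    (ha : 𝒢.sL (𝒢.one (𝒢.t g)) a = 0) :
    𝒢.rTransL (𝒢.mul g h) a = 𝒢.mulL g h (𝒢.rTransL g a, 0) := by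
  have h := 𝒢.mulL_assoc (u := a) (v := 0) (w := 0) (𝒢.s_one (𝒢.t g)) hc (by simp [ha]) (by simp)
  rw [𝒢.one_mul, mulL_zero_zero] at h
  rw [rTransL_apply, rTransL_apply, h, 𝒢.t_mul _ _ hc]

theorem sL_invL_one (x : M) (a : EG) :
    𝒢.sL (𝒢.one x) (𝒢.invL (𝒢.one x) a) = 𝒢.anchorL x a := by
  have h := 𝒢.sL_invL (𝒢.one x) a
  rwa [𝒢.inv_one] at h

theorem tL_invL_one {x : M} {a : EG} (ha : 𝒢.sL (𝒢.one x) a = 0) :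
    𝒢.tL (𝒢.one x) (𝒢.invL (𝒢.one x) a) = 0 := by
  have h := 𝒢.tL_invL (𝒢.one x) a
  rwa [𝒢.inv_one, ha] at h

theorem invL_one_mulL {x : M} {a : EG} (ha : 𝒢.sL (𝒢.one x) a = 0) :
    𝒢.mulL (𝒢.one x) (𝒢.one x) (𝒢.invL (𝒢.one x) a, a) = 0 := by
  have h := 𝒢.invL_mulL (𝒢.one x) a
  rwa [𝒢.inv_one, ha, map_zero] at h

theorem sL_lTransL {g : G} {a : EG} (ha : 𝒢.sL (𝒢.one (𝒢.s g)) a = 0) :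
    𝒢.sL g (𝒢.lTransL g a) = 𝒢.anchorL (𝒢.s g) a := by
  have h := 𝒢.sL_mulL (u := 0) (v := 𝒢.invL (𝒢.one (𝒢.s g)) a) (𝒢.t_one (𝒢.s g)).symm
    (by simp [tL_invL_one ha])
  rwa [𝒢.mul_one, sL_invL_one] at h

theorem tL_lTransL {g : G} {a : EG} (ha : 𝒢.sL (𝒢.one (𝒢.s g)) a = 0) :
    𝒢.tL g (𝒢.lTransL g a) = 0 := by
  have h := 𝒢.tL_mulL (u := 0) (v := 𝒢.invL (𝒢.one (𝒢.s g)) a) (𝒢.t_one (𝒢.s g)).symm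
    (by simp [tL_invL_one ha])
  rwa [𝒢.mul_one, map_zero] at h

theorem mulL_zero_lTransL {g h : G} {a : EG} (hc : 𝒢.s g = 𝒢.t h)
    (ha : 𝒢.sL (𝒢.one (𝒢.s h)) a = 0) :
    𝒢.mulL g h (0, 𝒢.lTransL h a) = 𝒢.lTransL (𝒢.mul g h) a := by
  have h1 := 𝒢.mulL_assoc (u := 0) (v := 0) (w := 𝒢.invL (𝒢.one (𝒢.s h)) a) hc
    (𝒢.t_one (𝒢.s h)).symm (by simp) (by simp [tL_invL_one ha])
  rw [𝒢.mul_one, mulL_zero_zero] at h1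
  rw [lTransL_apply, lTransL_apply, ← h1, 𝒢.s_mul _ _ hc]

/-- If a(τ) is a curve in a source fibre with velocity α at a unit, then (g a(τ)⁻¹)(a(τ) h) = gh is
constant. Algebraically, the factor dm(dι α, α) = 0 is isolated by using associativity twice. The
identity is used to trade a left translate in the first slot for a right translate in the second. -/
theorem mulL_lTransL_rTransL {g h : G} {a : EG} (hc : 𝒢.s g = 𝒢.t h)
    (ha : 𝒢.sL (𝒢.one (𝒢.s g)) a = 0) :
    𝒢.mulL g h (𝒢.lTransL g a, 𝒢.rTransL h a) = 0 := by
  have ha' : 𝒢.sL (𝒢.one (𝒢.t h)) a = 0 := by rwa [← hc]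
  have h1 := 𝒢.mulL_assoc (u := 0) (v := 𝒢.invL (𝒢.one (𝒢.s g)) a) (w := 𝒢.rTransL h a)
    (𝒢.t_one (𝒢.s g)).symm ((𝒢.s_one _).trans hc) (by simp [tL_invL_one ha])
    (by rw [tL_rTransL ha', sL_invL_one, hc])
  have h2 := 𝒢.mulL_assoc (u := 𝒢.invL (𝒢.one (𝒢.t h)) a) (v := a) (w := 0)
    ((𝒢.s_one (𝒢.t h)).trans (𝒢.t_one _).symm) (𝒢.s_one _)
    (by rw [sL_invL_one]; rfl) (by simp [ha'])
  rw [invL_one_mulL ha', mulL_zero_zero, 𝒢.one_mul, ← rTransL_apply] at h2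
  rw [𝒢.mul_one, ← lTransL_apply, hc, 𝒢.one_mul, ← h2, mulL_zero_zero] at h1
  exact h1

/-! ### The structure maps of the adjoint representation -/

section Connection

variable [IsManifold 𝓘(ℝ, EM) ∞ M] [IsManifold 𝓘(ℝ, EG) ∞ G]

namespace Connection

variable (c c' : 𝒢.Connection)

/-- The splitting `σ_g`, as a map of model spaces. -/
def sigL (g : G) : EM →L[ℝ] EG := c.σ g

/-- The map `ω_g`, as a map of model spaces. -/
def omL (g : G) : EG →L[ℝ] EG :=
  (𝒢.rInvL g).comp (ContinuousLinearMap.id ℝ EG - (c.sigL g).comp (𝒢.sL g))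

/-- The quasi-action on `TM`, as a map of model spaces. -/
def lamTL (g : G) : EM →L[ℝ] EM := (𝒢.tL g).comp (c.sigL g)

/-- The quasi-action on `A`, as a map of model spaces. -/
def lamAL (g : G) : EG →L[ℝ] EG := -(c.omL g).comp (𝒢.lTransL g)

/-- The basic curvature, as a map of model spaces. -/
def KL (g h : G) : EM →L[ℝ] EG :=
  (c.omL (𝒢.mul g h)).comp
    ((𝒢.mulL g h).comp (((c.sigL g).comp (c.lamTL h)).prod (c.sigL h)))

/-- The map `Ψ₁`, as a map of model spaces. -/
def psiL (g : G) : EM →L[ℝ] EG := (𝒢.rInvL g).comp (c.sigL g - c'.sigL g)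

variable {c c'}

theorem lamTL_apply (g : G) (X : EM) : c.lamTL g X = 𝒢.tL g (c.sigL g X) := rfl

theorem lamAL_apply (g : G) (a : EG) : c.lamAL g a = -c.omL g (𝒢.lTransL g a) := rfl

theorem KL_apply (g h : G) (X : EM) :
    c.KL g h X = c.omL (𝒢.mul g h) (𝒢.mulL g h (c.sigL g (c.lamTL h X), c.sigL h X)) := rfl

theorem psiL_apply (g : G) (X : EM) :
    c.psiL c' g X = 𝒢.rInvL g (c.sigL g X - c'.sigL g X) := rfl

theorem sL_sigL (g : G) (X : EM) : 𝒢.sL g (c.sigL g X) = X := c.ds_σ g X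

theorem sL_sub_sigL (g : G) (V : EG) : 𝒢.sL g (V - c.sigL g (𝒢.sL g V)) = 0 := by
  rw [map_sub, sL_sigL, sub_self]

theorem sL_sigL_sub_sigL (g : G) (X : EM) : 𝒢.sL g (c.sigL g X - c'.sigL g X) = 0 := by
  rw [map_sub, sL_sigL, sL_sigL, sub_self]

theorem sL_omL (g : G) (V : EG) : 𝒢.sL (𝒢.one (𝒢.t g)) (c.omL g V) = 0 :=
  sL_rInvL (sL_sub_sigL g V)

theorem sL_lamAL (g : G) (a : EG) : 𝒢.sL (𝒢.one (𝒢.t g)) (c.lamAL g a) = 0 := by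
  rw [lamAL_apply, map_neg, sL_omL, neg_zero]

theorem sL_KL {g h : G} (hc : 𝒢.s g = 𝒢.t h) (X : EM) :
    𝒢.sL (𝒢.one (𝒢.t g)) (c.KL g h X) = 0 := by
  rw [KL_apply, ← 𝒢.t_mul g h hc, sL_omL]

theorem sL_psiL (g : G) (X : EM) : 𝒢.sL (𝒢.one (𝒢.t g)) (c.psiL c' g X) = 0 :=
  sL_rInvL (sL_sigL_sub_sigL g X)

theorem rTransL_omL (g : G) (V : EG) : 𝒢.rTransL g (c.omL g V) = V - c.sigL g (𝒢.sL g V) :=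
  rTransL_rInvL (sL_sub_sigL g V)

/-- By definition r_g ω_g V = V − σ_g ds V, and ds(l_g α) = ρα. -/
theorem rTransL_lamAL {g : G} {a : EG} (ha : 𝒢.sL (𝒢.one (𝒢.s g)) a = 0) :
    𝒢.rTransL g (c.lamAL g a) = c.sigL g (𝒢.anchorL (𝒢.s g) a) - 𝒢.lTransL g a := by
  rw [lamAL_apply, map_neg, rTransL_omL, sL_lTransL ha, neg_sub]

theorem composable_sigL (g h : G) (X : EM) :
    𝒢.sL g (c.sigL g (c.lamTL h X)) = 𝒢.tL h (c.sigL h X) := by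
  rw [sL_sigL, lamTL_apply]

theorem rTransL_KL {g h : G} (hc : 𝒢.s g = 𝒢.t h) (X : EM) :
    𝒢.rTransL (𝒢.mul g h) (c.KL g h X) =
      𝒢.mulL g h (c.sigL g (c.lamTL h X), c.sigL h X) - c.sigL (𝒢.mul g h) X := by
  rw [KL_apply, rTransL_omL, sL_mulL hc (composable_sigL g h X), sL_sigL]

theorem rTransL_psiL (g : G) (X : EM) :
    𝒢.rTransL g (c.psiL c' g X) = c.sigL g X - c'.sigL g X :=
  rTransL_rInvL (sL_sigL_sub_sigL g X)

/-- Apply dt to `rTransL_lamAL`: it turns r_g into ρ and kills l_g α. -/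
theorem anchorL_lamAL {g : G} {a : EG} (ha : 𝒢.sL (𝒢.one (𝒢.s g)) a = 0) :
    𝒢.anchorL (𝒢.t g) (c.lamAL g a) = c.lamTL g (𝒢.anchorL (𝒢.s g) a) := by
  rw [← tL_rTransL (sL_lamAL g a), rTransL_lamAL ha, map_sub, tL_lTransL ha, sub_zero, lamTL_apply]

theorem anchorL_KL {g h : G} (hc : 𝒢.s g = 𝒢.t h) (X : EM) :
    𝒢.anchorL (𝒢.t g) (c.KL g h X) = c.lamTL g (c.lamTL h X) - c.lamTL (𝒢.mul g h) X := by
  have h1 : 𝒢.sL (𝒢.one (𝒢.t (𝒢.mul g h))) (c.KL g h X) = 0 := sL_omL _ _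
  rw [← 𝒢.t_mul g h hc, ← tL_rTransL h1, rTransL_KL hc, map_sub,
    tL_mulL hc (composable_sigL g h X)]
  rfl

theorem anchorL_psiL (g : G) (X : EM) :
    𝒢.anchorL (𝒢.t g) (c.psiL c' g X) = c.lamTL g X - c'.lamTL g X := by
  rw [← tL_rTransL (sL_psiL g X), rTransL_psiL, map_sub]
  rfl

/-- After right translation the terms l_g α, which do not involve the connection, cancel in the
difference. -/
theorem psiL_anchorL {g : G} {a : EG} (ha : 𝒢.sL (𝒢.one (𝒢.s g)) a = 0) :
    c.psiL c' g (𝒢.anchorL (𝒢.s g) a) = c.lamAL g a - c'.lamAL g a := by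
  refine rTransL_injective (𝒢 := 𝒢) (g := g) (sL_psiL _ _)
    (by rw [map_sub, sL_lamAL, sL_lamAL, sub_self]) ?_
  rw [map_sub, rTransL_lamAL ha, rTransL_lamAL ha, rTransL_psiL]
  abel

/-- Right translated to gh, the pair (σ_g λ_h ρα, σ_h ρα) is decomposed into (l_g λ_h α, r_h λ_h α),
on which dm vanishes, plus (r_g λ_g λ_h α, 0) and (0, l_h α), whose images are r_{gh} λ_g λ_h α and
l_{gh} α. -/
theorem KL_anchorL {g h : G} (hc : 𝒢.s g = 𝒢.t h) {a : EG}
    (ha : 𝒢.sL (𝒢.one (𝒢.s h)) a = 0) :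
    c.KL g h (𝒢.anchorL (𝒢.s h) a) = c.lamAL g (c.lamAL h a) - c.lamAL (𝒢.mul g h) a := by
  have ht := 𝒢.t_mul g h hc
  have ha' : 𝒢.sL (𝒢.one (𝒢.s (𝒢.mul g h))) a = 0 := by rwa [𝒢.s_mul g h hc]
  have hb : 𝒢.sL (𝒢.one (𝒢.s g)) (c.lamAL h a) = 0 := by rw [hc, sL_lamAL]
  refine rTransL_injective (𝒢 := 𝒢) (g := 𝒢.mul g h) (sL_omL _ _) ?_ ?_
  · rw [map_sub, sL_lamAL, ht, sL_lamAL, sub_self]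
  have h1 := mulL_lTransL_rTransL hc hb
  have h2 := anchorL_lamAL (c := c) ha
  rw [map_sub, rTransL_KL hc, rTransL_mul hc (sL_lamAL _ _), rTransL_lamAL hb, rTransL_lamAL ha',
    𝒢.s_mul g h hc, hc, h2, ← mulL_zero_lTransL hc ha]
  rw [rTransL_lamAL ha] at h1
  have h3 := (𝒢.mulL g h).map_add (𝒢.lTransL g (c.lamAL h a),
    c.sigL h (𝒢.anchorL (𝒢.s h) a) - 𝒢.lTransL h a)
    (c.sigL g (c.lamTL h (𝒢.anchorL (𝒢.s h) a)) - 𝒢.lTransL g (c.lamAL h a), 0)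
  have h4 := (𝒢.mulL g h).map_add (c.sigL g (c.lamTL h (𝒢.anchorL (𝒢.s h) a)),
    c.sigL h (𝒢.anchorL (𝒢.s h) a) - 𝒢.lTransL h a) (0, 𝒢.lTransL h a)
  simp only [Prod.mk_add_mk, add_zero, sub_add_cancel, add_sub_cancel] at h3 h4
  rw [h4, h3, h1]
  abel

/-- Right translated to ghk, this expresses associativity of dm on the triple (σ_g λ_h λ_k X, σ_h
λ_k X, σ_k X). -/
theorem KL_cocycle {g h k : G} (hgh : 𝒢.s g = 𝒢.t h) (hhk : 𝒢.s h = 𝒢.t k) (X : EM) :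
    c.lamAL g (c.KL h k X) - c.KL (𝒢.mul g h) k X + c.KL g (𝒢.mul h k) X
      - c.KL g h (c.lamTL k X) = 0 := by
  have hghk : 𝒢.s g = 𝒢.t (𝒢.mul h k) := by rw [𝒢.t_mul _ _ hhk, hgh]
  have hghk' : 𝒢.s (𝒢.mul g h) = 𝒢.t k := by rw [𝒢.s_mul _ _ hgh, hhk]
  have ht : 𝒢.t (𝒢.mul g (𝒢.mul h k)) = 𝒢.t g := 𝒢.t_mul _ _ hghk
  have hκ : 𝒢.sL (𝒢.one (𝒢.s g)) (c.KL h k X) = 0 := by rw [hgh, sL_KL hhk]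
  have hK : 𝒢.sL (𝒢.one (𝒢.t g)) (c.KL (𝒢.mul g h) k X) = 0 := by
    rw [← 𝒢.t_mul g h hgh, sL_KL hghk']
  refine rTransL_injective (𝒢 := 𝒢) (g := 𝒢.mul g (𝒢.mul h k)) ?_ (map_zero (𝒢.sL _)) ?_
  · rw [ht, map_sub, map_add, map_sub, sL_lamAL, hK, sL_KL hghk, sL_KL hgh]
    simp
  -- λ_g K(h,k)X contributes −l_g K(h,k)X in the first slot; this replaces it by r_{hk} K(h,k)X in
  -- the second, which `rTransL_KL` makes explicit.
  have h1 := mulL_lTransL_rTransL hghk hκ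
  have hρ := anchorL_KL (c := c) hhk X
  have ha := 𝒢.mulL_assoc hgh hhk (composable_sigL (c := c) g h (c.lamTL k X))
    (composable_sigL h k X)
  have h2 := rTransL_KL (c := c) hghk' X
  have h3 : 𝒢.rTransL (𝒢.mul (𝒢.mul g h) k) (c.KL g h (c.lamTL k X)) = _ :=
    rTransL_mul hghk' (sL_omL _ _)
  rw [rTransL_KL hgh] at h3
  rw [𝒢.mul_assoc _ _ _ hgh hhk] at h2 h3
  rw [rTransL_KL hhk] at h1
  simp only [map_sub, map_add, map_zero]
  rw [h2, h3, rTransL_KL hghk, rTransL_mul hghk (sL_lamAL _ _), rTransL_lamAL hκ, hgh, hρ]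
  rw [mulL_eq_add] at h1 ha
  rw [mulL_eq_add g (𝒢.mul h k)] at ha
  rw [mulL_eq_add _ k (c.sigL (𝒢.mul g h) _), mulL_eq_add g (𝒢.mul h k) (c.sigL g (c.lamTL _ X))]
  have hl : ∀ g h : G, ∀ u v : EG, 𝒢.mulL g h (u - v, 0) = 𝒢.mulL g h (u, 0) - 𝒢.mulL g h (v, 0) :=
    fun g h u v => by rw [← map_sub]; simp
  have hr : ∀ g h : G, ∀ u v : EG, 𝒢.mulL g h (0, u - v) = 𝒢.mulL g h (0, u) - 𝒢.mulL g h (0, v) :=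
    fun g h u v => by rw [← map_sub]; simp
  simp only [hl, hr, map_sub] at h1 ha ⊢
  linear_combination (norm := module) -h1 - ha

/-- The left translate in λ'_g Ψ₁(h)X is traded for r_h Ψ₁(h)X = σ_h X − σ'_h X in the second slot.
With ρΨ₁ = λ − λ', bilinear-looking terms collapse by linearity of dm alone. -/
theorem psiL_cocycle {g h : G} (hc : 𝒢.s g = 𝒢.t h) (X : EM) :
    c'.lamAL g (c.psiL c' h X) - c.psiL c' (𝒢.mul g h) X + c.psiL c' g (c.lamTL h X) =
      c.KL g h X - c'.KL g h X := by
  have hψ : 𝒢.sL (𝒢.one (𝒢.s g)) (c.psiL c' h X) = 0 := by rw [hc, sL_psiL]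
  have ht : 𝒢.t (𝒢.mul g h) = 𝒢.t g := 𝒢.t_mul _ _ hc
  refine rTransL_injective (𝒢 := 𝒢) (g := 𝒢.mul g h) ?_ ?_ ?_
  · rw [map_add, map_sub, sL_psiL, ht, sL_lamAL, sL_psiL]; simp
  · rw [map_sub, ht, sL_KL hc, sL_KL hc, sub_self]
  have h1 := mulL_lTransL_rTransL hc hψ
  have hρ := anchorL_psiL (c := c) (c' := c') h X
  rw [rTransL_psiL] at h1
  simp only [map_sub, map_add]
  rw [rTransL_KL hc, rTransL_KL hc, rTransL_psiL, rTransL_mul hc (sL_lamAL _ _),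
    rTransL_mul hc (sL_psiL _ _), rTransL_psiL, rTransL_lamAL hψ, hc, hρ]
  rw [mulL_eq_add] at h1
  rw [mulL_eq_add g h (c.sigL g _) (c.sigL h X), mulL_eq_add g h (c'.sigL g _) (c'.sigL h X)]
  have hl : ∀ u v : EG, 𝒢.mulL g h (u - v, 0) = 𝒢.mulL g h (u, 0) - 𝒢.mulL g h (v, 0) :=
    fun u v => by rw [← map_sub]; simp
  have hr : ∀ u v : EG, 𝒢.mulL g h (0, u - v) = 𝒢.mulL g h (0, u) - 𝒢.mulL g h (0, v) :=
    fun u v => by rw [← map_sub]; simp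
  simp only [hl, hr, map_sub] at h1 ⊢
  linear_combination (norm := module) -h1

end Connection

end Connection

end LieGroupoid

namespace LieGroupoid

variable {EM : Type u₁} [NormedAddCommGroup EM] [NormedSpace ℝ EM]
  {EG : Type u₂} [NormedAddCommGroup EG] [NormedSpace ℝ EG]
  {M : Type u₃} [TopologicalSpace M] [ChartedSpace EM M]
  {G : Type u₄} [TopologicalSpace G] [ChartedSpace EG G]
  {𝒢 : LieGroupoid EM EG M G}

/-! ### Simplicial identities -/

namespace Nerve

theorem arr_congr {n : ℕ} (p : 𝒢.Nerve n) {i j : Fin n} (h : i.val = j.val) : p.arr i = p.arr j :=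
  congrArg p.arr (Fin.ext h)

theorem vert_congr {n : ℕ} (p : 𝒢.Nerve n) {i j : Fin (n + 1)} (h : i.val = j.val) :
    p.vert i = p.vert j :=
  congrArg p.vert (Fin.ext h)

theorem face_arr_of_lt {n : ℕ} (p : 𝒢.Nerve (n + 1)) {i : Fin (n + 2)} {j : Fin n}
    (h : j.val + 1 < i.val) : (p.face i).arr j = p.arr j.castSucc := by
  simp [face, h]

theorem face_arr_of_eq {n : ℕ} (p : 𝒢.Nerve (n + 1)) {i : Fin (n + 2)} {j : Fin n}
    (h : j.val + 1 = i.val) : (p.face i).arr j = 𝒢.mul (p.arr j.castSucc) (p.arr j.succ) := by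
  simp [face, h]

theorem face_arr_of_gt {n : ℕ} (p : 𝒢.Nerve (n + 1)) {i : Fin (n + 2)} {j : Fin n}
    (h : i.val < j.val + 1) : (p.face i).arr j = p.arr j.succ := by
  have h1 : ¬ j.val + 1 < i.val := by omega
  have h2 : ¬ j.val + 1 = i.val := by omega
  simp only [face, if_neg h1, if_neg h2]

theorem face_vert_of_lt {n : ℕ} (p : 𝒢.Nerve (n + 1)) {i : Fin (n + 2)} {j : Fin (n + 1)}
    (h : j.val < i.val) : (p.face i).vert j = p.vert j.castSucc := by
  have : j.castSucc < i := h
  simp [face, Fin.succAbove, this]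

theorem face_vert_of_ge {n : ℕ} (p : 𝒢.Nerve (n + 1)) {i : Fin (n + 2)} {j : Fin (n + 1)}
    (h : i.val ≤ j.val) : (p.face i).vert j = p.vert j.succ := by
  have : ¬ j.castSucc < i := not_lt.2 h
  simp [face, Fin.succAbove, this]

theorem face_face {n : ℕ} (p : 𝒢.Nerve (n + 2)) {i j : Fin (n + 2)} (hij : i ≤ j) :
    (p.face j.succ).face i = (p.face i.castSucc).face j := by
  have hij' : i.val ≤ j.val := hij
  ext k
  · rcases lt_or_ge k.val i.val with h1 | h1
    · rw [face_vert_of_lt _ h1, face_vert_of_lt _ (by simp; omega), face_vert_of_lt _ (by omega),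
        face_vert_of_lt _ (by simpa using h1)]
    · rw [face_vert_of_ge _ h1]
      rcases lt_or_ge k.val j.val with h2 | h2
      · rw [face_vert_of_lt _ (by simpa using h2), face_vert_of_lt _ h2,
          face_vert_of_ge _ (by simpa using h1)]
        rfl
      · rw [face_vert_of_ge _ (by simpa using h2), face_vert_of_ge _ h2,
          face_vert_of_ge _ (by simp; omega)]
  · rcases lt_trichotomy (k.val + 1) i.val with h1 | h1 | h1
    · rw [face_arr_of_lt _ h1, face_arr_of_lt _ (by simp; omega), face_arr_of_lt _ (by omega),
        face_arr_of_lt _ (by simpa using h1)]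
    · rw [face_arr_of_eq _ h1]
      rw [face_arr_of_lt _ (show k.castSucc.val + 1 < j.succ.val by simp; omega)]
      rcases lt_or_eq_of_le hij' with h2 | h2
      · rw [face_arr_of_lt _ (by simp; omega), face_arr_of_lt _ (by omega),
          face_arr_of_eq _ (by simpa using h1)]
        rfl
      -- Here i = j and three consecutive arrows are merged into one, the only case that needs
      -- associativity.
      · rw [face_arr_of_eq _ (by simp; omega), face_arr_of_eq _ (by omega),
          face_arr_of_eq _ (by simpa using h1), face_arr_of_gt _ (by simp; omega)]
        exact (𝒢.mul_assoc _ _ _ (p.composable k.val (by omega))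
          (p.composable (k.val + 1) (by omega))).symm
    · rw [face_arr_of_gt _ h1]
      rcases lt_trichotomy (k.val + 1) j.val with h2 | h2 | h2
      · rw [face_arr_of_lt _ (by simpa using h2), face_arr_of_lt _ h2,
          face_arr_of_gt _ (by simpa using h1)]
        rfl
      · rw [face_arr_of_eq _ (by simpa using h2), face_arr_of_eq _ h2,
          face_arr_of_gt _ (by simpa using h1), face_arr_of_gt _ (by simp; omega)]
        rfl
      · rw [face_arr_of_gt _ (by simpa using h2), face_arr_of_gt _ h2,
          face_arr_of_gt _ (by simp; omega)]

theorem face_succ_face_zero {n : ℕ} (p : 𝒢.Nerve (n + 2)) (j : Fin (n + 2)) :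
    (p.face j.succ).face 0 = (p.face 0).face j :=
  p.face_face (Fin.zero_le j)

theorem face_zero_arr {n : ℕ} (p : 𝒢.Nerve (n + 1)) (j : Fin n) : (p.face 0).arr j = p.arr j.succ :=
  p.face_arr_of_gt (by simp)

theorem face_one_arr_zero {n : ℕ} (p : 𝒢.Nerve (n + 2)) :
    (p.face 1).arr 0 = 𝒢.mul (p.arr 0) (p.arr 1) :=
  p.face_arr_of_eq (by simp)

theorem face_succ_succ_arr_zero {n : ℕ} (p : 𝒢.Nerve (n + 2)) (j : Fin (n + 1)) :
    (p.face j.succ.succ).arr 0 = p.arr 0 :=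
  p.face_arr_of_lt (by simp)

/-- `(g_1, …, g_{k+m}) ↦ (g_{k+1}, …, g_{k+m})`. -/
def drop {n : ℕ} (k m : ℕ) (h : k + m = n) (p : 𝒢.Nerve n) : 𝒢.Nerve m where
  vert j := p.vert ⟨k + j.val, by omega⟩
  arr j := p.arr ⟨k + j.val, by omega⟩
  t_arr j := p.t_arr _
  s_arr j := p.s_arr _

/-- Replaces the degree `n - k`, on which types depend, by an independent `m` with `k + m = n`. -/
theorem apply_back {α : Type*} (f : ∀ n, 𝒢.Nerve n → α) {n k m : ℕ} (h : k + m = n)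
    (hk : k ≤ n) (p : 𝒢.Nerve n) : f (n - k) (p.back k hk) = f m (p.drop k m h) := by
  obtain rfl : m = n - k := by omega
  rfl

/-! ### Faces of a string cut in two -/

section FrontDrop

variable {n k m : ℕ} (p : 𝒢.Nerve (n + 1))

theorem face_drop_of_le {i : Fin (n + 2)} (h : k + m = n) (hi : i.val ≤ k) :
    (p.face i).drop k m h = p.drop (k + 1) m (by omega) := by
  ext j
  · refine (p.face_vert_of_ge (by simp; omega)).trans (p.vert_congr ?_)
    simp; omega
  · refine (p.face_arr_of_gt (by simp; omega)).trans (p.arr_congr ?_)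
    simp; omega

theorem face_front_of_le {i : Fin (n + 2)} (h : k ≤ n) (hi : i.val ≤ k) :
    (p.face i).front k h = (p.front (k + 1) (by omega)).face ⟨i.val, by omega⟩ := by
  ext j
  · simp only [front]
    rcases lt_or_ge j.val i.val with h1 | h1
    · rw [face_vert_of_lt _ (by simpa using h1), face_vert_of_lt _ (by simpa using h1)]; rfl
    · rw [face_vert_of_ge _ (by simpa using h1), face_vert_of_ge _ (by simpa using h1)]; rfl
  · simp only [front]
    rcases lt_trichotomy (j.val + 1) i.val with h1 | h1 | h1
    · rw [face_arr_of_lt _ (by simpa using h1), face_arr_of_lt _ (by simpa using h1)]; rfl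
    · rw [face_arr_of_eq _ (by simpa using h1), face_arr_of_eq _ (by simpa using h1)]; rfl
    · rw [face_arr_of_gt _ (by simpa using h1), face_arr_of_gt _ (by simpa using h1)]; rfl

theorem face_front_of_gt {i : Fin (n + 2)} (h : k ≤ n) (hi : k < i.val) :
    (p.face i).front k h = p.front k (by omega) := by
  ext j
  · exact p.face_vert_of_lt (by simp; omega)
  · exact p.face_arr_of_lt (by simp; omega)

theorem face_drop_of_ge {i : Fin (n + 2)} (h : k + m = n) (hi : k ≤ i.val) :
    (p.face i).drop k m h = (p.drop k (m + 1) (by omega)).face ⟨i.val - k, by omega⟩ := by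
  ext j
  · simp only [drop]
    rcases lt_or_ge (k + j.val) i.val with h1 | h1
    · rw [face_vert_of_lt _ (by simpa using h1), face_vert_of_lt _ (by simp; omega)]; rfl
    · rw [face_vert_of_ge _ (by simpa using h1), face_vert_of_ge _ (by simp; omega)]; rfl
  · simp only [drop]
    rcases lt_trichotomy (k + j.val + 1) i.val with h1 | h1 | h1
    · rw [face_arr_of_lt _ (by simpa using h1), face_arr_of_lt _ (by simp; omega)]; rfl
    · rw [face_arr_of_eq _ (by simpa using h1), face_arr_of_eq _ (by simp; omega)]; rfl
    · rw [face_arr_of_gt _ (by simpa using h1), face_arr_of_gt _ (by simp; omega)]; rfl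

theorem front_face_last (h : k + 1 ≤ n + 1) :
    (p.front (k + 1) h).face (Fin.last (k + 1)) = p.front k (by omega) := by
  ext j
  · exact (face_vert_of_lt _ (by simp; omega)).trans (p.vert_congr (by simp))
  · exact (face_arr_of_lt _ (by simp)).trans (p.arr_congr (by simp))

theorem drop_face_zero (h : k + (m + 1) = n + 1) :
    (p.drop k (m + 1) h).face 0 = p.drop (k + 1) m (by omega) := by
  ext j
  · exact (face_vert_of_ge _ (by simp)).trans (p.vert_congr (by simp; omega))
  · exact (face_arr_of_gt _ (by simp)).trans (p.arr_congr (by simp; omega))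

end FrontDrop

end Nerve

/-! ### Operators on families of functions on the nerve -/

section Operators

variable {E E' : Type*} [NormedAddCommGroup E] [NormedSpace ℝ E]
  [NormedAddCommGroup E'] [NormedSpace ℝ E']

variable (𝒢) in
/-- Families of functions on the `G_n` with values in a fixed vector space. -/
abbrev Fam (E : Type*) : Type _ := ∀ n : ℕ, 𝒢.Nerve n → E

/-- Multiplication by `(-1)^n` in degree `n`. -/
def sgn : 𝒢.Fam E →ₗ[ℝ] 𝒢.Fam E where
  toFun ξ n p := (-1 : ℝ) ^ n • ξ n p
  map_add' ξ ζ := by ext n p; simp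
  map_smul' r ξ := by ext n p; simp [smul_comm r]

/-- Postcomposition with a family of linear maps depending on the target. -/
def fib (ρ : M → E →L[ℝ] E') : 𝒢.Fam E →ₗ[ℝ] 𝒢.Fam E' where
  toFun ξ n p := ρ p.tgt (ξ n p)
  map_add' ξ ζ := by ext n p; simp
  map_smul' r ξ := by ext n p; simp

/-- The sum `∑_{i=1}^{n+1} (-1)^i d_i^*`. -/
def faceSum (ξ : 𝒢.Fam E) (n : ℕ) (p : 𝒢.Nerve (n + 1)) : E :=
  ∑ i : Fin (n + 1), (-1 : ℝ) ^ (i.val + 1) • ξ n (p.face i.succ)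

/-- The operator `η ↦ P(g_1) η(g_2, …)`. -/
def shift (P : G → E →L[ℝ] E') : 𝒢.Fam E →ₗ[ℝ] 𝒢.Fam E' where
  toFun ξ n := match n with
    | 0 => fun _ => 0
    | n + 1 => fun p => P (p.arr 0) (ξ n (p.face 0))
  map_add' ξ ζ := by ext n p; cases n <;> simp
  map_smul' r ξ := by ext n p; cases n <;> simp

/-- The operator `η ↦ K(g_1, g_2) η(g_3, …)`. -/
def shift₂ (K : G → G → E →L[ℝ] E') : 𝒢.Fam E →ₗ[ℝ] 𝒢.Fam E' where
  toFun ξ n := match n with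
    | 0 => fun _ => 0
    | 1 => fun _ => 0
    | n + 2 => fun p => K (p.arr 0) (p.arr 1) (ξ n ((p.face 0).face 0))
  map_add' ξ ζ := by ext n p; rcases n with _ | _ | n <;> simp
  map_smul' r ξ := by ext n p; rcases n with _ | _ | n <;> simp

/-- The operator `η ↦ Λ(g_1) η(g_2, …) + ∑_{i ≥ 1} (-1)^i d_i^* η`. -/
def dhat (Λ : G → E →L[ℝ] E) : 𝒢.Fam E →ₗ[ℝ] 𝒢.Fam E where
  toFun ξ n := match n with
    | 0 => fun _ => 0
    | n + 1 => fun p => Λ (p.arr 0) (ξ n (p.face 0)) + faceSum ξ n p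
  map_add' ξ ζ := by
    ext n p; cases n
    · simp
    · simp [faceSum, Finset.sum_add_distrib]; abel
  map_smul' r ξ := by
    ext n p; cases n
    · simp
    · simp [faceSum, Finset.smul_sum, smul_comm r]

@[simp] theorem sgn_apply (ξ : 𝒢.Fam E) (n : ℕ) (p : 𝒢.Nerve n) :
    sgn ξ n p = (-1 : ℝ) ^ n • ξ n p := rfl

@[simp] theorem fib_apply (ρ : M → E →L[ℝ] E') (ξ : 𝒢.Fam E) (n : ℕ) (p : 𝒢.Nerve n) :
    fib ρ ξ n p = ρ p.tgt (ξ n p) := rfl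

@[simp] theorem shift_zero (P : G → E →L[ℝ] E') (ξ : 𝒢.Fam E) (p : 𝒢.Nerve 0) :
    shift P ξ 0 p = 0 := rfl

@[simp] theorem shift_succ (P : G → E →L[ℝ] E') (ξ : 𝒢.Fam E) (n : ℕ) (p : 𝒢.Nerve (n + 1)) :
    shift P ξ (n + 1) p = P (p.arr 0) (ξ n (p.face 0)) := rfl

@[simp] theorem shift₂_zero (K : G → G → E →L[ℝ] E') (ξ : 𝒢.Fam E) (p : 𝒢.Nerve 0) :
    shift₂ K ξ 0 p = 0 := rfl

@[simp] theorem shift₂_one (K : G → G → E →L[ℝ] E') (ξ : 𝒢.Fam E) (p : 𝒢.Nerve 1) :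
    shift₂ K ξ 1 p = 0 := rfl

@[simp] theorem shift₂_add_two (K : G → G → E →L[ℝ] E') (ξ : 𝒢.Fam E) (n : ℕ)
    (p : 𝒢.Nerve (n + 2)) :
    shift₂ K ξ (n + 2) p = K (p.arr 0) (p.arr 1) (ξ n ((p.face 0).face 0)) := rfl

@[simp] theorem dhat_zero (Λ : G → E →L[ℝ] E) (ξ : 𝒢.Fam E) (p : 𝒢.Nerve 0) :
    dhat Λ ξ 0 p = 0 := rfl

theorem dhat_succ (Λ : G → E →L[ℝ] E) (ξ : 𝒢.Fam E) (n : ℕ) (p : 𝒢.Nerve (n + 1)) :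
    dhat Λ ξ (n + 1) p = Λ (p.arr 0) (ξ n (p.face 0)) + faceSum ξ n p := rfl

theorem sgn_sgn (ξ : 𝒢.Fam E) : sgn (sgn ξ) = ξ := by
  ext n p
  simp [smul_smul, ← mul_pow]

theorem fib_sgn (ρ : M → E →L[ℝ] E') (ξ : 𝒢.Fam E) : fib ρ (sgn ξ) = sgn (fib ρ ξ) := by
  ext n p; simp

/-- Operators of odd degree anticommute with `sgn`, those of even degree commute with it. Together
with `sgn_sgn` these rules handle all signs in the structure equations. -/
theorem shift_sgn (P : G → E →L[ℝ] E') (ξ : 𝒢.Fam E) : shift P (sgn ξ) = -sgn (shift P ξ) := by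
  ext n p; cases n <;> simp [pow_succ]

theorem shift₂_sgn (K : G → G → E →L[ℝ] E') (ξ : 𝒢.Fam E) :
    shift₂ K (sgn ξ) = sgn (shift₂ K ξ) := by
  ext n p; rcases n with _ | _ | n <;> simp [pow_succ]

theorem dhat_sgn (Λ : G → E →L[ℝ] E) (ξ : 𝒢.Fam E) : dhat Λ (sgn ξ) = -sgn (dhat Λ ξ) := by
  ext n p
  cases n with
  | zero => simp
  | succ n =>
    simp [dhat_succ, faceSum, pow_succ, smul_smul, Finset.smul_sum, mul_comm, add_comm]

/-- The cancellation behind δ² = 0: the terms (i, j) with i ≤ j are paired with the terms (j + 1,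
i), which have the opposite sign. Natural number indices make the bijection expressible without
bounds in the types. -/
theorem sum_neg_one_pow_add_eq_zero (n : ℕ) (F : ℕ → ℕ → E)
    (hF : ∀ i j, i ≤ j → j ≤ n → F (j + 1) i = F i j) :
    ∑ i ∈ Finset.range (n + 2), ∑ j ∈ Finset.range (n + 1), (-1 : ℝ) ^ (i + j) • F i j = 0 := by
  have h1 : ∀ i ∈ Finset.range (n + 2),
      ∑ j ∈ Finset.range (n + 1), (-1 : ℝ) ^ (i + j) • F i j =
        ∑ j ∈ Finset.range (n + 1) with i ≤ j, (-1 : ℝ) ^ (i + j) • F i j +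
          ∑ j ∈ Finset.range (n + 1) with ¬ i ≤ j, (-1 : ℝ) ^ (i + j) • F i j := fun i _ =>
    (Finset.sum_filter_add_sum_filter_not _ _ _).symm
  rw [Finset.sum_congr rfl h1, Finset.sum_add_distrib, Finset.sum_sigma', Finset.sum_sigma',
    add_eq_zero_iff_eq_neg, ← Finset.sum_neg_distrib]
  refine Finset.sum_bij' (fun x _ => ⟨x.2 + 1, x.1⟩) (fun x _ => ⟨x.2, x.1 - 1⟩) ?_ ?_ ?_ ?_ ?_
  · rintro ⟨i, j⟩ h; simp at h ⊢; omega
  · rintro ⟨i, j⟩ h; simp at h ⊢; omega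
  · rintro ⟨i, j⟩ h; simp
  · rintro ⟨i, j⟩ h; simp at h ⊢; omega
  · rintro ⟨i, j⟩ h
    simp at h
    simp only
    rw [hF i j h.2.2 (by omega), ← neg_smul]
    congr 1
    ring

theorem faceSum_faceSum (ξ : 𝒢.Fam E) (n : ℕ) (p : 𝒢.Nerve (n + 2)) :
    ∑ i : Fin (n + 2), (-1 : ℝ) ^ (i.val + 1) • faceSum ξ n (p.face i.succ) = 0 := by
  let F : ℕ → ℕ → E := fun i j =>
    if h : i < n + 2 ∧ j < n + 1 then
      ξ n ((p.face (⟨i, h.1⟩ : Fin (n + 2)).succ).face (⟨j, h.2⟩ : Fin (n + 1)).succ) else 0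
  have hF : ∀ i j, i ≤ j → j ≤ n → F (j + 1) i = F i j := fun i j hij hj => by
    have h1 : j + 1 < n + 2 ∧ i < n + 1 := by omega
    have h2 : i < n + 2 ∧ j < n + 1 := by omega
    simp only [F, dif_pos h1, dif_pos h2]
    congr 1
    exact p.face_face (i := (⟨i, h1.2⟩ : Fin (n + 1)).succ) (j := ⟨j + 1, h1.1⟩)
      (by simp [Fin.le_def, hij])
  have h := sum_neg_one_pow_add_eq_zero n F hF
  rw [← Fin.sum_univ_eq_sum_range (fun i => ∑ j ∈ Finset.range (n + 1), (-1 : ℝ) ^ (i + j) • F i j)]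
    at h
  refine Eq.trans (Finset.sum_congr rfl fun i _ => ?_) h
  rw [← Fin.sum_univ_eq_sum_range (fun j => (-1 : ℝ) ^ (i.val + j) • F i j), faceSum,
    Finset.smul_sum]
  refine Finset.sum_congr rfl fun j _ => ?_
  have h1 : i.val < n + 2 ∧ j.val < n + 1 := ⟨i.2, j.2⟩
  simp only [F, dif_pos h1, smul_smul]
  congr 1
  ring

/-- The double face sums cancel, and the faces keeping g_1 cancel against Λ(g_1) of the inner face
sum. Besides Λ(g_1)Λ(g_2), only the first face remains, which merges g_1 and g_2. -/
theorem dhat_dhat (Λ : G → E →L[ℝ] E) (ξ : 𝒢.Fam E) :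
    dhat Λ (dhat Λ ξ) = shift₂ (fun g h => (Λ g).comp (Λ h) - Λ (𝒢.mul g h)) ξ := by
  ext n p
  rcases n with _ | _ | n
  · simp
  · simp [dhat_succ, faceSum]
  · have h0 : (p.face 1).face 0 = (p.face 0).face 0 := p.face_succ_face_zero 0
    have h1 : faceSum (dhat Λ ξ) (n + 1) p =
        -Λ (𝒢.mul (p.arr 0) (p.arr 1)) (ξ n ((p.face 0).face 0)) -
          Λ (p.arr 0) (faceSum ξ n (p.face 0)) := by
      have h2 := faceSum_faceSum ξ n p
      rw [Fin.sum_univ_succ] at h2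
      rw [faceSum, Fin.sum_univ_succ]
      simp only [dhat_succ, smul_add, Finset.sum_add_distrib]
      rw [add_add_add_comm, h2, add_zero, faceSum, map_sum, sub_eq_add_neg,
        ← Finset.sum_neg_distrib]
      congr 1
      · simp [Nerve.face_one_arr_zero, h0]
      · refine Finset.sum_congr rfl fun j _ => ?_
        rw [Nerve.face_succ_succ_arr_zero, Nerve.face_succ_face_zero]
        simp [pow_succ]
    rw [dhat_succ, dhat_succ, h1, shift₂_add_two, Nerve.face_zero_arr]
    simp only [map_add, sub_apply, ContinuousLinearMap.comp_apply]
    have : (Fin.succ 0 : Fin (n + 2)) = 1 := rfl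
    rw [this]
    abel

/-- Faces from the third on leave g_1, g_2 alone and commute past `K`, the two resulting sign
changes cancelling. The first two faces and the two quasi-action terms are the four terms of `hK`.
-/
theorem dhat_shift₂ (Λ : G → E →L[ℝ] E) (Λ' : G → E' →L[ℝ] E') (K : G → G → E →L[ℝ] E')
    (hK : ∀ g h k, 𝒢.s g = 𝒢.t h → 𝒢.s h = 𝒢.t k → ∀ X,
      Λ' g (K h k X) - K (𝒢.mul g h) k X + K g (𝒢.mul h k) X - K g h (Λ k X) = 0)
    (ξ : 𝒢.Fam E) : dhat Λ' (shift₂ K ξ) = shift₂ K (dhat Λ ξ) := by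
  ext n p
  rcases n with _ | _ | _ | n
  · simp
  · simp [dhat_succ, faceSum]
  · simp [dhat_succ, faceSum]
  · have h1 : (p.face 1).face 0 = (p.face 0).face 0 := p.face_succ_face_zero 0
    have h2 : (p.face 2).face 0 = (p.face 0).face 1 := p.face_succ_face_zero 1
    have h3 : ((p.face 0).face 1).face 0 = ((p.face 0).face 0).face 0 :=
      (p.face 0).face_succ_face_zero 0
    have a1 : (p.face 1).arr 1 = p.arr 2 := p.face_arr_of_gt (by simp)
    have a2 : (p.face 2).arr 0 = p.arr 0 := p.face_succ_succ_arr_zero 0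
    have a3 : (p.face 2).arr 1 = 𝒢.mul (p.arr 1) (p.arr 2) :=
      p.face_arr_of_eq (i := Fin.succ (Fin.succ 0))
        (by simp only [Fin.val_succ, Fin.val_zero, Fin.val_one])
    have a4 : ((p.face 0).face 0).arr 0 = p.arr 2 := by
      rw [Nerve.face_zero_arr, Nerve.face_zero_arr]; rfl
    have a5 : (p.face 0).arr 0 = p.arr 1 := p.face_zero_arr 0
    have a6 : (p.face 0).arr 1 = p.arr 2 := p.face_zero_arr 1
    have h4 : faceSum (shift₂ K ξ) (n + 2) p =
        -K (𝒢.mul (p.arr 0) (p.arr 1)) (p.arr 2) (ξ n (((p.face 0).face 0).face 0)) +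
        K (p.arr 0) (𝒢.mul (p.arr 1) (p.arr 2)) (ξ n (((p.face 0).face 0).face 0)) +
        K (p.arr 0) (p.arr 1) (faceSum ξ n ((p.face 0).face 0)) := by
      rw [faceSum, Fin.sum_univ_succ, Fin.sum_univ_succ, faceSum, map_sum, ← add_assoc]
      congr 1
      · congr 1
        · simp [Nerve.face_one_arr_zero, h1, a1]
        · simp [a2, a3, h2, h3]
      · refine Finset.sum_congr rfl fun j _ => ?_
        have b1 : (p.face j.succ.succ.succ).arr 1 = p.arr 1 := p.face_arr_of_lt (by simp)
        rw [shift₂_add_two, Nerve.face_succ_succ_arr_zero, b1, Nerve.face_succ_face_zero,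
          Nerve.face_succ_face_zero]
        simp [pow_succ]
    have h5 := hK (p.arr 0) (p.arr 1) (p.arr 2) (p.composable 0 (by omega))
      (p.composable 1 (by omega)) (ξ n (((p.face 0).face 0).face 0))
    rw [dhat_succ, h4, shift₂_add_two, shift₂_add_two, dhat_succ, a4, a5, a6, map_add]
    linear_combination (norm := module) h5

/-- The same argument with one leading arrow; the sum, rather than a difference, appears because
`shift` has odd degree. -/
theorem dhat_shift_add_shift_dhat (Λ : G → E →L[ℝ] E) (Λ' : G → E' →L[ℝ] E') (P : G → E →L[ℝ] E')
    (K K' : G → G → E →L[ℝ] E')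
    (hP : ∀ g h, 𝒢.s g = 𝒢.t h → ∀ X,
      Λ' g (P h X) - P (𝒢.mul g h) X + P g (Λ h X) = K g h X - K' g h X)
    (ξ : 𝒢.Fam E) :
    dhat Λ' (shift P ξ) + shift P (dhat Λ ξ) = shift₂ K ξ - shift₂ K' ξ := by
  ext n p
  rcases n with _ | _ | n
  · simp
  · simp [dhat_succ, faceSum]
  · have h1 : (p.face 1).face 0 = (p.face 0).face 0 := p.face_succ_face_zero 0
    have a5 : (p.face 0).arr 0 = p.arr 1 := p.face_zero_arr 0
    have h4 : faceSum (shift P ξ) (n + 1) p =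
        -P (𝒢.mul (p.arr 0) (p.arr 1)) (ξ n ((p.face 0).face 0)) -
          P (p.arr 0) (faceSum ξ n (p.face 0)) := by
      rw [faceSum, Fin.sum_univ_succ, faceSum, map_sum, sub_eq_add_neg, ← Finset.sum_neg_distrib]
      congr 1
      · simp [Nerve.face_one_arr_zero, h1]
      · refine Finset.sum_congr rfl fun j _ => ?_
        rw [shift_succ, Nerve.face_succ_succ_arr_zero, Nerve.face_succ_face_zero]
        simp [pow_succ]
    have h5 := hP (p.arr 0) (p.arr 1) (p.composable 0 (by omega)) (ξ n ((p.face 0).face 0))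
    simp only [Pi.add_apply, Pi.sub_apply]
    rw [dhat_succ, h4, shift_succ, shift_succ, shift₂_add_two, shift₂_add_two, dhat_succ, a5,
      map_add]
    linear_combination (norm := module) h5

end Operators

/-! ### Compatibility with the right module structure -/

section Star

variable {E E' : Type*} [NormedAddCommGroup E] [NormedSpace ℝ E]
  [NormedAddCommGroup E'] [NormedSpace ℝ E']

/-- The right action of scalar cochains on families of functions on the nerve. -/
def starFam (ξ : 𝒢.Fam E) (f : 𝒢.Fam ℝ) : 𝒢.Fam E := fun n p =>
  ∑ k : Fin (n + 1), ((-1) ^ (k.val * (n - k.val)) * f (n - k.val)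
    (p.back k.val (Nat.le_of_lt_succ k.isLt))) • ξ k.val (p.front k.val (Nat.le_of_lt_succ k.isLt))

theorem starFam_add (ξ ζ : 𝒢.Fam E) (f : 𝒢.Fam ℝ) :
    starFam (ξ + ζ) f = starFam ξ f + starFam ζ f := by
  ext n p
  simp [starFam, Finset.sum_add_distrib]

theorem starFam_neg (ξ : 𝒢.Fam E) (f : 𝒢.Fam ℝ) : starFam (-ξ) f = -starFam ξ f := by
  ext n p
  simp [starFam]

theorem zero_starFam (f : 𝒢.Fam ℝ) : starFam (0 : 𝒢.Fam E) f = 0 := by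
  ext n p
  simp [starFam]

theorem starFam_fib (ρ : M → E →L[ℝ] E') (ξ : 𝒢.Fam E) (f : 𝒢.Fam ℝ) :
    starFam (fib ρ ξ) f = fib ρ (starFam ξ f) := by
  ext n p
  simp [starFam, Nerve.tgt_front]

theorem apply_back_face_zero (f : 𝒢.Fam ℝ) {n : ℕ} (p : 𝒢.Nerve (n + 1)) {k : ℕ} (hk : k ≤ n)
    (hk' : k + 1 ≤ n + 1) :
    f (n + 1 - (k + 1)) (p.back (k + 1) hk') = f (n - k) ((p.face 0).back k hk) := by
  rw [Nerve.apply_back f (show (k + 1) + (n - k) = n + 1 by omega),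
    Nerve.apply_back f (show k + (n - k) = n by omega),
    Nerve.face_drop_of_le p (i := 0) (by omega) (by simp)]

/-- The factor of `sgn` compensates the change of the sign (-1)^(km) when k increases by one;
without it `shift` would be linear only up to sign. -/
theorem starFam_sgn_shift (P : G → E →L[ℝ] E') (ξ : 𝒢.Fam E) (f : 𝒢.Fam ℝ) :
    starFam (sgn (shift P ξ)) f = sgn (shift P (starFam ξ f)) := by
  ext n p
  cases n with
  | zero => simp [starFam]
  | succ n =>
    simp only [starFam, sgn_apply, shift_succ]
    rw [Fin.sum_univ_succ, map_sum, Finset.smul_sum]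
    simp only [Fin.val_zero, shift_zero, smul_zero, zero_add, Fin.val_succ, shift_succ, map_smul,
      smul_smul]
    refine Finset.sum_congr rfl fun k _ => ?_
    have hk : k.val ≤ n := Nat.le_of_lt_succ k.isLt
    rw [apply_back_face_zero f p hk (by omega), Nerve.face_front_of_le p (i := 0) hk (by simp)]
    congr 1
    obtain ⟨m, hm⟩ := Nat.exists_eq_add_of_le hk
    have h1 : n + 1 - (k.val + 1) = m := by omega
    have h2 : n - k.val = m := by omega
    have h4 : ∀ k n : ℕ, n = k + m → (-1 : ℝ) ^ ((k + 1) * m) * (-1) ^ (k + 1) =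
        (-1) ^ (n + 1) * (-1) ^ (k * m) := by
      rintro k _ rfl; ring
    rw [h1, mul_right_comm, ← _root_.mul_assoc, h4 _ _ hm, ← h2]

theorem starFam_shift₂ (K : G → G → E →L[ℝ] E') (ξ : 𝒢.Fam E) (f : 𝒢.Fam ℝ) :
    starFam (shift₂ K ξ) f = shift₂ K (starFam ξ f) := by
  ext n p
  rcases n with _ | _ | n
  · simp [starFam]
  · simp [starFam, Fin.sum_univ_succ]
  · simp only [starFam, shift₂_add_two]
    rw [Fin.sum_univ_succ, Fin.sum_univ_succ, map_sum (K (p.arr 0) (p.arr 1))]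
    have h0 : ∀ q, shift₂ K ξ (0 + 1) q = 0 := fun _ => rfl
    simp only [Fin.val_zero, shift₂_zero, smul_zero, zero_add, Fin.val_succ, h0,
      shift₂_add_two, map_smul]
    refine Finset.sum_congr rfl fun k _ => ?_
    have hk : k.val ≤ n := Nat.le_of_lt_succ k.isLt
    rw [apply_back_face_zero f p (k := k.val + 1) (by omega) (by omega),
      apply_back_face_zero f (p.face 0) hk (by omega),
      Nerve.face_front_of_le (p.face 0) (i := 0) hk (by simp),
      Nerve.face_front_of_le p (i := 0) (k := k.val + 1) (by omega) (by simp)]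
    congr 2
    have h1 : n + 1 + 1 - (k.val + 1 + 1) = n - k.val := by omega
    rw [h1, add_mul, add_mul, pow_add, pow_add, _root_.mul_assoc, ← mul_pow]
    simp

theorem starFam_of_concentrated {ξ : 𝒢.Fam E} {k : ℕ} (hξ : ∀ j, j ≠ k → ξ j = 0) (f : 𝒢.Fam ℝ)
    {n m : ℕ} (h : k + m = n) (p : 𝒢.Nerve n) :
    starFam ξ f n p =
      ((-1) ^ (k * m) * f m (p.drop k m h)) • ξ k (p.front k (by omega)) := by
  rw [starFam, Finset.sum_eq_single (⟨k, by omega⟩ : Fin (n + 1))]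
  · rw [Nerve.apply_back f h]
    have : n - k = m := by omega
    simp only [this]
  · intro j _ hj
    have : ξ j.val = 0 := hξ _ fun h' => hj (Fin.ext h')
    simp [this]
  · simp

theorem starFam_of_lt {ξ : 𝒢.Fam E} {k : ℕ} (hξ : ∀ j, j ≠ k → ξ j = 0) (f : 𝒢.Fam ℝ)
    {n : ℕ} (h : n < k) (p : 𝒢.Nerve n) : starFam ξ f n p = 0 := by
  refine Finset.sum_eq_zero fun j _ => ?_
  have : ξ j.val = 0 := hξ _ (by omega)
  simp [this]

theorem dhat_concentrated (Λ : G → E →L[ℝ] E) {ξ : 𝒢.Fam E} {k : ℕ}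
    (hξ : ∀ j, j ≠ k → ξ j = 0) (j : ℕ) (hj : j ≠ k + 1) : dhat Λ ξ j = 0 := by
  ext p
  cases j with
  | zero => simp
  | succ j => simp [dhat_succ, faceSum, hξ j (by omega)]

theorem sgn_concentrated {ξ : 𝒢.Fam E} {k : ℕ}
    (hξ : ∀ j, j ≠ k → ξ j = 0) (j : ℕ) (hj : j ≠ k) : sgn ξ j = 0 := by
  ext p
  simp [hξ j hj]

theorem scalarδ_succ_eq (f : 𝒢.Fam ℝ) (n : ℕ) (p : 𝒢.Nerve (n + 1)) :
    scalarδ f (n + 1) p = (-1) ^ n * (f n (p.face 0) +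
      ∑ i : Fin (n + 1), (-1) ^ (i.val + 1) * f n (p.face i.succ)) := by
  rw [scalarδ, Fin.sum_univ_succ]
  simp

/-- Leibniz rule: the faces of a string of k + m + 1 arrows act either on the part where ξ is
evaluated or on the part where f is. The sign involves the nerve degree k, not the total degree. -/
theorem sgn_dhat_starFam (Λ : G → E →L[ℝ] E) {ξ : 𝒢.Fam E} {k : ℕ} (hξ : ∀ j, j ≠ k → ξ j = 0)
    (f : 𝒢.Fam ℝ) :
    sgn (dhat Λ (starFam ξ f)) =
      starFam (sgn (dhat Λ ξ)) f - (-1 : ℝ) ^ k • starFam ξ (scalarδ f) := by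
  have hd := sgn_concentrated (dhat_concentrated Λ hξ)
  ext n p
  simp only [Pi.sub_apply, Pi.smul_apply]
  cases n with
  | zero => simp [starFam, scalarδ]
  | succ n =>
    -- Below degree k + 1 everything vanishes; in degree k itself because δ f has no component in
    -- degree 0.
    rcases lt_or_ge n k with hn | hn
    · have h0 : starFam ξ f n = 0 := funext fun q => starFam_of_lt hξ f hn q
      have h1 : starFam ξ (scalarδ f) (n + 1) p = 0 := by
        rcases lt_or_eq_of_le (Nat.succ_le_of_lt hn) with h | h
        · exact starFam_of_lt hξ _ h p
        · rw [starFam_of_concentrated hξ _ (m := 0) (by simpa using h.symm)]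
          simp [scalarδ]
      rw [h1, starFam_of_lt hd f (by omega)]
      simp [dhat_succ, faceSum, h0]
    · obtain ⟨m, rfl⟩ := Nat.exists_eq_add_of_le hn
      have hsum : faceSum (starFam ξ f) (k + m) p =
          ((-1 : ℝ) ^ (k * m) * f m (p.drop (k + 1) m (by omega))) •
            ∑ i : Fin k, (-1 : ℝ) ^ (i.val + 1) • ξ k ((p.front (k + 1) (by omega)).face
              i.castSucc.succ) +
          ((-1 : ℝ) ^ (k * m + k) * ∑ j : Fin (m + 1), (-1 : ℝ) ^ (j.val + 1) *
            f m ((p.drop k (m + 1) (by omega)).face j.succ)) • ξ k (p.front k (by omega)) := by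
        rw [faceSum]
        -- The faces d_1, …, d_k act on the first part of the string, d_{k+1}, …, d_{k+m+1} on the
        -- rest.
        have := Fin.sum_univ_add (a := k) (b := m + 1) (fun i : Fin (k + (m + 1)) =>
          (-1 : ℝ) ^ (i.val + 1) • starFam ξ f (k + m) (p.face (Fin.succ i)))
        refine this.trans ?_
        rw [Finset.smul_sum, Finset.mul_sum, Finset.sum_smul]
        congr 1
        · refine Finset.sum_congr rfl fun i _ => ?_
          rw [starFam_of_concentrated hξ f rfl,
            Nerve.face_drop_of_le p (i := Fin.succ (Fin.castAdd (m + 1) i)) rfl (by simp),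
            Nerve.face_front_of_le p (i := Fin.succ (Fin.castAdd (m + 1) i)) (by omega)
              (by simp), smul_comm]
          rfl
        · refine Finset.sum_congr rfl fun j _ => ?_
          rw [starFam_of_concentrated hξ f rfl,
            Nerve.face_drop_of_ge p (i := Fin.succ (Fin.natAdd k j)) rfl (by simp; omega),
            Nerve.face_front_of_gt p (i := Fin.succ (Fin.natAdd k j)) (by omega)
              (by simp), smul_smul]
          have hj : (⟨(Fin.succ (Fin.natAdd k j)).val - k, by simp; omega⟩ : Fin (m + 2)) =
              j.succ := by
            ext; simp; omega
          rw [hj]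
          congr 1
          simp only [Fin.val_natAdd]
          ring
      rw [starFam_of_concentrated hd f (n := k + m + 1) (m := m) (by omega),
        starFam_of_concentrated hξ (scalarδ f) (n := k + m + 1) (m := m + 1) (by omega)]
      have h0 : starFam ξ f (k + m) (p.face 0) = ((-1 : ℝ) ^ (k * m) *
          f m (p.drop (k + 1) m (by omega))) • ξ k ((p.front (k + 1) (by omega)).face 0) := by
        rw [starFam_of_concentrated hξ f rfl, Nerve.face_drop_of_le p (i := 0) rfl (by simp),
          Nerve.face_front_of_le p (i := 0) (by omega) (by simp)]
        rfl
      -- The face forgetting g_{k+1} has no counterpart in `hsum`. Its contribution cancels against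
      -- the zeroth face in δ f.
      have hl : faceSum ξ k (p.front (k + 1) (by omega)) =
          ∑ i : Fin k, (-1 : ℝ) ^ (i.val + 1) • ξ k ((p.front (k + 1) (by omega)).face
              i.castSucc.succ) + (-1 : ℝ) ^ (k + 1) • ξ k (p.front k (by omega)) := by
        rw [faceSum, Fin.sum_univ_castSucc, Fin.succ_last, Nerve.front_face_last]
        rfl
      rw [sgn_apply, sgn_apply, dhat_succ, dhat_succ, hsum, h0, hl, scalarδ_succ_eq,
        Nerve.drop_face_zero, map_smul]
      have ha : (p.front (k + 1) (by omega)).arr 0 = p.arr 0 := rfl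
      rw [ha]
      have h1 : ((-1 : ℝ) ^ k) ^ 2 = 1 := by rw [← pow_mul]; simp
      have h2 : (-1 : ℝ) ^ ((k + 1) * m) = (-1) ^ (k * m) * (-1) ^ m := by ring
      have h3 : (-1 : ℝ) ^ (k * (m + 1)) = (-1) ^ (k * m) * (-1) ^ k := by ring
      rw [h2, h3, pow_add _ (k * m) k, pow_succ _ (k + m), pow_add _ k m, pow_succ _ k]
      generalize (-1 : ℝ) ^ k = x at *
      generalize (-1 : ℝ) ^ m = y at *
      generalize (-1 : ℝ) ^ (k * m) = z at *
      match_scalars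
      · ring
      · ring
      · ring_nf

end Star

/-! ### The operators of the adjoint representation in model spaces -/

theorem anchor_eq (x : M) (a : EG) : (𝒢.anchor x a : EM) = 𝒢.anchorL x a :=
  tcast_eq (𝒢.t_one x) (𝒢.tL (𝒢.one x) a)

theorem rInv_eq (g : G) (W : EG) : (𝒢.rInv g W : EG) = 𝒢.rInvL g W :=
  tcast_eq (𝒢.mul_inv g) (𝒢.mulL g (𝒢.inv g) (W, 0))

theorem lTrans_eq (g : G) (a : EG) : (𝒢.lTrans g a : EG) = 𝒢.lTransL g a := by
  refine (tcast_eq (𝒢.mul_one g) _).trans ?_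
  have h := tcast_eq (𝒢.inv_one_s g) (𝒢.invL (𝒢.one (𝒢.s g)) a)
  exact congrArg (fun v : EG => 𝒢.mulL g (𝒢.one (𝒢.s g)) (0, v)) h

variable (𝒢) in
/-- The `A`-component of a family, with values in the model space. -/
def fstL : 𝒢.RawCochain →ₗ[ℝ] 𝒢.Fam EG where
  toFun η := η.1
  map_add' _ _ := rfl
  map_smul' _ _ := rfl

variable (𝒢) in
/-- The `TM`-component of a family, with values in the model space. -/
def sndL : 𝒢.RawCochain →ₗ[ℝ] 𝒢.Fam EM where
  toFun η := η.2
  map_add' _ _ := rfl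
  map_smul' _ _ := rfl

theorem rawCochain_ext {η ζ : 𝒢.RawCochain} (h₁ : 𝒢.fstL η = 𝒢.fstL ζ)
    (h₂ : 𝒢.sndL η = 𝒢.sndL ζ) : η = ζ :=
  Prod.ext h₁ h₂

theorem fstL_rawStar (η : 𝒢.RawCochain) (f : 𝒢.RawScalar) :
    𝒢.fstL (rawStar η f) = starFam (𝒢.fstL η) f := rfl

theorem sndL_rawStar (η : 𝒢.RawCochain) (f : 𝒢.RawScalar) :
    𝒢.sndL (rawStar η f) = starFam (𝒢.sndL η) f := rfl

theorem fstL_anchorOp (η : 𝒢.RawCochain) : 𝒢.fstL (anchorOp η) = 0 := rfl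

theorem sndL_anchorOp (η : 𝒢.RawCochain) :
    𝒢.sndL (anchorOp η) = fib 𝒢.anchorL (𝒢.fstL η) := by
  ext n p
  exact anchor_eq _ _

section Connection

variable [IsManifold 𝓘(ℝ, EM) ∞ M] [IsManifold 𝓘(ℝ, EG) ∞ G]

namespace Connection

theorem ω_eq (c : 𝒢.Connection) (g : G) (V : EG) : (c.ω g V : EG) = c.omL g V :=
  rInv_eq g (V - c.sigL g (𝒢.sL g V))

theorem lamA_eq (c : 𝒢.Connection) (g : G) (a : EG) : (c.lamA g a : EG) = c.lamAL g a :=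
  congrArg (fun v : EG => -v)
    ((c.ω_eq g _).trans (congrArg (fun v : EG => c.omL g v) (lTrans_eq g a)))

theorem K_eq (c : 𝒢.Connection) (g h : G) (hc : 𝒢.s g = 𝒢.t h) (X : EM) :
    (c.K g h hc X : EG) = c.KL g h X := by
  refine (tcast_eq (congrArg 𝒢.one (𝒢.t_mul g h hc)) _).trans ((c.ω_eq _ _).trans ?_)
  exact congrArg (fun Y : EM => c.omL (𝒢.mul g h) (𝒢.mulL g h (c.sigL g Y, c.sigL h X)))
    (tcast_eq hc.symm (c.lamTL h X))

theorem psi1_eq (c c' : 𝒢.Connection) (g : G) (X : EM) :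
    (Connection.psi1 c c' g X : EG) = c.psiL c' g X :=
  rInv_eq g (c.sigL g X - c'.sigL g X)

end Connection

theorem fstL_quasiOp (c : 𝒢.Connection) (η : 𝒢.RawCochain) :
    𝒢.fstL (quasiOp c η) = -sgn (dhat c.lamAL (𝒢.fstL η)) := by
  ext n p
  cases n with
  | zero => simp; rfl
  | succ n =>
    have h1 : (tcast (congrArg 𝒢.one p.t_arr_zero)
        (c.lamA (p.arr 0) (tcast (congrArg 𝒢.one p.tgt_face_zero) (η.1 n (p.face 0)))) : EG) =
        c.lamAL (p.arr 0) (𝒢.fstL η n (p.face 0)) :=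
      (tcast_eq _ _).trans ((c.lamA_eq _ _).trans
        (congrArg (fun v : EG => c.lamAL (p.arr 0) v) (tcast_eq _ _)))
    have h2 : ∀ i : Fin (n + 1),
        (tcast (congrArg 𝒢.one (p.tgt_face_succ i)) (η.1 n (p.face i.succ)) : EG) =
          𝒢.fstL η n (p.face i.succ) := fun i => tcast_eq _ _
    -- The defining formula with its summands abstracted as vectors of the model space, so that `h1`
    -- and `h2` can be inserted without rewriting under dependent types.
    have h3 : ∀ (x : EG) (y : Fin (n + 1) → EG), (tcast (congrArg 𝒢.one p.t_arr_zero)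
        (c.lamA (p.arr 0) (tcast (congrArg 𝒢.one p.tgt_face_zero) (η.1 n (p.face 0)))) : EG) = x →
        (∀ i, (tcast (congrArg 𝒢.one (p.tgt_face_succ i)) (η.1 n (p.face i.succ)) : EG) = y i) →
        𝒢.fstL (quasiOp c η) (n + 1) p =
          (-1 : ℝ) ^ n • (x + ∑ i : Fin (n + 1), (-1 : ℝ) ^ (i.val + 1) • y i) := by
      rintro x y rfl hy
      obtain rfl := funext hy
      rfl
    rw [h3 _ _ h1 h2]
    -- `sgn` sees the output degree n + 1, while the sign of the A-component is (-1)^n; this is the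
    -- origin of the minus sign.
    rw [Pi.neg_apply, Pi.neg_apply, sgn_apply, dhat_succ, faceSum, pow_succ, mul_neg_one, neg_smul,
      neg_neg]

theorem sndL_quasiOp (c : 𝒢.Connection) (η : 𝒢.RawCochain) :
    𝒢.sndL (quasiOp c η) = sgn (dhat c.lamTL (𝒢.sndL η)) := by
  ext n p
  cases n with
  | zero => simp; rfl
  | succ n =>
    have h1 : (tcast p.t_arr_zero
        (c.lamT (p.arr 0) (tcast p.tgt_face_zero (η.2 n (p.face 0)))) : EM) =
        c.lamTL (p.arr 0) (𝒢.sndL η n (p.face 0)) :=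
      (tcast_eq _ _).trans (congrArg (fun v : EM => c.lamTL (p.arr 0) v) (tcast_eq _ _))
    have h2 : ∀ i : Fin (n + 1),
        (tcast (p.tgt_face_succ i) (η.2 n (p.face i.succ)) : EM) =
          𝒢.sndL η n (p.face i.succ) := fun i => tcast_eq _ _
    have h3 : ∀ (x : EM) (y : Fin (n + 1) → EM), (tcast p.t_arr_zero
        (c.lamT (p.arr 0) (tcast p.tgt_face_zero (η.2 n (p.face 0)))) : EM) = x →
        (∀ i, (tcast (p.tgt_face_succ i) (η.2 n (p.face i.succ)) : EM) = y i) →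
        𝒢.sndL (quasiOp c η) (n + 1) p =
          (-1 : ℝ) ^ (n + 1) • (x + ∑ i : Fin (n + 1), (-1 : ℝ) ^ (i.val + 1) • y i) := by
      rintro x y rfl hy
      obtain rfl := funext hy
      rfl
    rw [h3 _ _ h1 h2]
    simp [dhat_succ, faceSum]

theorem fstL_curvOp (c : 𝒢.Connection) (η : 𝒢.RawCochain) :
    𝒢.fstL (curvOp c η) = shift₂ c.KL (𝒢.sndL η) := by
  ext n p
  rcases n with _ | _ | n
  · rfl
  · rfl
  · exact (tcast_eq _ _).trans ((c.K_eq _ _ _ _).trans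
      (congrArg (fun v : EM => c.KL (p.arr 0) (p.arr 1) v) (tcast_eq _ _)))

theorem sndL_curvOp (c : 𝒢.Connection) (η : 𝒢.RawCochain) : 𝒢.sndL (curvOp c η) = 0 := rfl

theorem fstL_psi1Op (c c' : 𝒢.Connection) (η : 𝒢.RawCochain) :
    𝒢.fstL (psi1Op c c' η) = sgn (shift (c.psiL c') (𝒢.sndL η)) := by
  ext n p
  cases n with
  | zero => simp; rfl
  | succ n =>
    exact congrArg (fun v : EG => (-1 : ℝ) ^ (n + 1) • v) ((tcast_eq _ _).trans
      ((Connection.psi1_eq c c' _ _).trans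
      (congrArg (fun v : EM => c.psiL c' (p.arr 0) v) (tcast_eq _ _))))

theorem sndL_psi1Op (c c' : 𝒢.Connection) (η : 𝒢.RawCochain) : 𝒢.sndL (psi1Op c c' η) = 0 := rfl

theorem fstL_adOp (c : 𝒢.Connection) (η : 𝒢.RawCochain) :
    𝒢.fstL (adOp c η) = -sgn (dhat c.lamAL (𝒢.fstL η)) + shift₂ c.KL (𝒢.sndL η) := by
  rw [adOp, map_add, map_add, fstL_anchorOp, fstL_quasiOp, fstL_curvOp, zero_add]

theorem sndL_adOp (c : 𝒢.Connection) (η : 𝒢.RawCochain) :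
    𝒢.sndL (adOp c η) = fib 𝒢.anchorL (𝒢.fstL η) + sgn (dhat c.lamTL (𝒢.sndL η)) := by
  rw [adOp, map_add, map_add, sndL_anchorOp, sndL_quasiOp, sndL_curvOp, add_zero]

theorem adOp_add (c : 𝒢.Connection) (η ζ : 𝒢.RawCochain) :
    adOp c (η + ζ) = adOp c η + adOp c ζ := by
  refine rawCochain_ext ?_ ?_
  · simp only [map_add, fstL_adOp]; abel
  · simp only [map_add, sndL_adOp]; abel

theorem adOp_smul (c : 𝒢.Connection) (r : ℝ) (η : 𝒢.RawCochain) :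
    adOp c (r • η) = r • adOp c η := by
  refine rawCochain_ext ?_ ?_
  · simp only [map_smul, fstL_adOp, smul_add, smul_neg]
  · simp only [map_smul, sndL_adOp, smul_add]

theorem psi1Op_add (c c' : 𝒢.Connection) (η ζ : 𝒢.RawCochain) :
    psi1Op c c' (η + ζ) = psi1Op c c' η + psi1Op c c' ζ := by
  refine rawCochain_ext ?_ ?_
  · simp only [map_add, fstL_psi1Op]
  · simp only [map_add, sndL_psi1Op, add_zero]

theorem psi1Op_smul (c c' : 𝒢.Connection) (r : ℝ) (η : 𝒢.RawCochain) :
    psi1Op c c' (r • η) = r • psi1Op c c' η := by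
  refine rawCochain_ext ?_ ?_
  · simp only [map_smul, fstL_psi1Op]
  · simp only [map_smul, sndL_psi1Op, smul_zero]

theorem psi1Op_swap (c c' : 𝒢.Connection) (η : 𝒢.RawCochain) :
    psi1Op c' c η = -psi1Op c c' η := by
  refine rawCochain_ext ?_ ?_
  · rw [map_neg, fstL_psi1Op, fstL_psi1Op, ← map_neg]
    congr 1
    ext n p
    cases n with
    | zero => simp
    | succ n => simp [Connection.psiL_apply]
  · rw [map_neg, sndL_psi1Op, sndL_psi1Op, neg_zero]

/-- Ψ₁ reads only the TM-component and produces only an A-component. Combined with `psi1Op_swap`,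
this makes the morphisms for (σ, σ') and (σ', σ) mutually inverse. -/
theorem psi1Op_psi1Op (c c' d d' : 𝒢.Connection) (η : 𝒢.RawCochain) :
    psi1Op d d' (psi1Op c c' η) = 0 := by
  refine rawCochain_ext ?_ ?_
  · rw [fstL_psi1Op, sndL_psi1Op, map_zero, map_zero, map_zero]
  · rw [sndL_psi1Op, map_zero]

/-! ### The structure equations -/

section Identities

variable {a : 𝒢.Fam EG} (b : 𝒢.Fam EM) (c c' : 𝒢.Connection)

theorem fib_anchorL_dhat (ha : ∀ n p, 𝒢.sL (𝒢.one p.tgt) (a n p) = 0) :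
    fib 𝒢.anchorL (dhat c.lamAL a) = dhat c.lamTL (fib 𝒢.anchorL a) := by
  ext n p
  cases n with
  | zero => simp
  | succ n =>
    have h := ha n (p.face 0)
    rw [p.tgt_face_zero] at h
    have h1 := Connection.anchorL_lamAL (c := c) h
    rw [p.t_arr_zero] at h1
    simp only [fib_apply, dhat_succ, faceSum, map_add, map_sum, map_smul, h1, p.tgt_face_zero,
      p.tgt_face_succ]

theorem shift_psiL_fib (ha : ∀ n p, 𝒢.sL (𝒢.one p.tgt) (a n p) = 0) :
    shift (c.psiL c') (fib 𝒢.anchorL a) = dhat c.lamAL a - dhat c'.lamAL a := by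
  ext n p
  cases n with
  | zero => simp
  | succ n =>
    have h := ha n (p.face 0)
    rw [p.tgt_face_zero] at h
    have h1 := Connection.psiL_anchorL (c := c) (c' := c') h
    simp only [Pi.sub_apply, shift_succ, fib_apply, dhat_succ, p.tgt_face_zero, h1,
      add_sub_add_right_eq_sub]

theorem dhat_dhat_lamAL (ha : ∀ n p, 𝒢.sL (𝒢.one p.tgt) (a n p) = 0) :
    dhat c.lamAL (dhat c.lamAL a) = shift₂ c.KL (fib 𝒢.anchorL a) := by
  rw [dhat_dhat]
  ext n p
  rcases n with _ | _ | n
  · simp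
  · simp
  · have h := ha n ((p.face 0).face 0)
    rw [p.tgt_face_zero_zero] at h
    have h1 := Connection.KL_anchorL (c := c) p.s_arr_zero h
    simp only [shift₂_add_two, fib_apply, p.tgt_face_zero_zero, h1, sub_apply,
      ContinuousLinearMap.comp_apply]

theorem dhat_dhat_lamTL :
    dhat c.lamTL (dhat c.lamTL b) = fib 𝒢.anchorL (shift₂ c.KL b) := by
  rw [dhat_dhat]
  ext n p
  rcases n with _ | _ | n
  · simp
  · simp
  · have h1 := Connection.anchorL_KL (c := c) p.s_arr_zero (b n ((p.face 0).face 0))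
    rw [p.t_arr_zero] at h1
    simp only [shift₂_add_two, fib_apply, h1, sub_apply, ContinuousLinearMap.comp_apply]

theorem fib_shift_psiL :
    fib 𝒢.anchorL (shift (c.psiL c') b) = dhat c.lamTL b - dhat c'.lamTL b := by
  ext n p
  cases n with
  | zero => simp
  | succ n =>
    have h1 := Connection.anchorL_psiL (c := c) (c' := c') (p.arr 0) (b n (p.face 0))
    rw [p.t_arr_zero] at h1
    simp only [Pi.sub_apply, shift_succ, fib_apply, dhat_succ, h1, add_sub_add_right_eq_sub]

theorem dhat_shift₂_KL :
    dhat c.lamAL (shift₂ c.KL b) = shift₂ c.KL (dhat c.lamTL b) :=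
  dhat_shift₂ _ _ _ (fun _ _ _ h1 h2 X => Connection.KL_cocycle h1 h2 X) b

theorem dhat_shift_psiL :
    dhat c'.lamAL (shift (c.psiL c') b) + shift (c.psiL c') (dhat c.lamTL b) =
      shift₂ c.KL b - shift₂ c'.KL b :=
  dhat_shift_add_shift_dhat _ _ _ _ _ (fun _ _ h1 X => Connection.psiL_cocycle h1 X) b

end Identities

/-- With D(a, b) = (−S d a + K b, ρ a + S d b), S the sign operator, the rules dS = −Sd, S² = 1 and
KS = SK reduce D² to the structure equations. Membership of a in A is needed since λ on A is
controlled only on Ker ds. -/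
theorem adOp_adOp (c : 𝒢.Connection) {η : 𝒢.RawCochain}
    (hη : ∀ n p, 𝒢.sL (𝒢.one p.tgt) (𝒢.fstL η n p) = 0) : adOp c (adOp c η) = 0 := by
  refine rawCochain_ext ?_ ?_
  · rw [fstL_adOp, sndL_adOp, fstL_adOp]
    simp only [map_add, map_neg, dhat_sgn, sgn_sgn, shift₂_sgn, dhat_dhat_lamAL _ hη,
      dhat_shift₂_KL, map_zero]
    abel
  · rw [sndL_adOp, sndL_adOp, fstL_adOp]
    simp only [map_add, map_neg, dhat_sgn, sgn_sgn, fib_sgn, fib_anchorL_dhat _ hη,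
      dhat_dhat_lamTL, map_zero]
    abel

theorem adOp_add_psi1Op (c c' : 𝒢.Connection) {η : 𝒢.RawCochain}
    (hη : ∀ n p, 𝒢.sL (𝒢.one p.tgt) (𝒢.fstL η n p) = 0) :
    adOp c η + psi1Op c c' (adOp c η) = adOp c' (η + psi1Op c c' η) := by
  refine rawCochain_ext ?_ ?_
  · rw [map_add, fstL_psi1Op, sndL_adOp, fstL_adOp, fstL_adOp, map_add 𝒢.fstL, map_add 𝒢.sndL,
      fstL_psi1Op, sndL_psi1Op, map_add, map_add]
    have h := dhat_shift_psiL (𝒢.sndL η) c c'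
    simp only [map_add, map_sub, map_neg, dhat_sgn, sgn_sgn, shift_sgn, shift_psiL_fib _ _ hη,
      add_zero]
    linear_combination (norm := module) -h
  · rw [map_add, sndL_psi1Op, sndL_adOp, sndL_adOp, map_add 𝒢.fstL, map_add 𝒢.sndL,
      fstL_psi1Op, sndL_psi1Op]
    simp only [map_add, map_sub, fib_sgn, fib_shift_psiL, add_zero]
    abel

theorem adOp_rawStar (c : 𝒢.Connection) {n : ℕ} {η : 𝒢.RawCochain} (hη : 𝒢.IsHomogeneous n η)
    (f : 𝒢.RawScalar) :
    adOp c (rawStar η f) = rawStar (adOp c η) f + (-1 : ℝ) ^ n • rawStar η (scalarδ f) := by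
  have h1 : ∀ k, k ≠ n → 𝒢.fstL η k = 0 := hη.1
  have h2 : sgn (dhat c.lamTL (starFam (𝒢.sndL η) f)) =
      starFam (sgn (dhat c.lamTL (𝒢.sndL η))) f +
        (-1 : ℝ) ^ n • starFam (𝒢.sndL η) (scalarδ f) := by
    -- The TM-component of an element of total degree n sits in nerve degree k = n − 1, so −(−1)^k
    -- is the required (−1)^n; for n = 0 it is zero.
    cases n with
    | zero =>
      have h0 : 𝒢.sndL η = 0 := funext fun k => hη.2 k (Nat.succ_ne_zero k)
      simp [h0, zero_starFam]
    | succ k =>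
      have h0 : ∀ j, j ≠ k → 𝒢.sndL η j = 0 := fun j hj => hη.2 j (by omega)
      rw [sgn_dhat_starFam _ h0, pow_succ]
      module
  refine rawCochain_ext ?_ ?_
  · rw [map_add, map_smul, fstL_adOp, fstL_rawStar, fstL_rawStar, fstL_rawStar, sndL_rawStar,
      fstL_adOp, starFam_add, starFam_neg, starFam_shift₂, sgn_dhat_starFam _ h1]
    module
  · rw [map_add, map_smul, sndL_adOp, sndL_rawStar, sndL_rawStar, sndL_rawStar, fstL_rawStar,
      sndL_adOp, starFam_add, starFam_fib, h2, add_assoc]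

theorem psi1Op_rawStar (c c' : 𝒢.Connection) (η : 𝒢.RawCochain) (f : 𝒢.RawScalar) :
    psi1Op c c' (rawStar η f) = rawStar (psi1Op c c' η) f := by
  refine rawCochain_ext ?_ ?_
  · rw [fstL_rawStar, fstL_psi1Op, fstL_psi1Op, sndL_rawStar, starFam_sgn_shift]
  · rw [sndL_rawStar, sndL_psi1Op, sndL_psi1Op]
    ext n p
    simp [starFam]

end Connection

theorem IsSmoothFamily.face {n d : ℕ} {p : EuclideanSpace ℝ (Fin d) → 𝒢.Nerve (n + 1)}
    (hp : IsSmoothFamily p) (i : Fin (n + 2)) : IsSmoothFamily fun u => (p u).face i := by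
  refine ⟨fun j => hp.1 _, fun j => ?_⟩
  rcases lt_trichotomy (j.val + 1) i.val with h | h | h
  · exact (hp.2 j.castSucc).congr fun u => (p u).face_arr_of_lt h
  · refine ContMDiff.congr ?_ fun u => (p u).face_arr_of_eq h
    exact 𝒢.mul_smooth.comp_contMDiff ((hp.2 j.castSucc).prodMk (hp.2 j.succ))
      fun u => (p u).composable j.val (by omega)
  · exact (hp.2 j.succ).congr fun u => (p u).face_arr_of_gt h

/-! ### Smooth families -/

section SmoothFam

variable {E : Type*} [NormedAddCommGroup E] [NormedSpace ℝ E]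
  {X : Type*} [TopologicalSpace X] [ChartedSpace E X] [IsManifold 𝓘(ℝ, E) ∞ X]
  {E' : Type*} [NormedAddCommGroup E'] [NormedSpace ℝ E']
  {Y : Type*} [TopologicalSpace Y] [ChartedSpace E' Y] [IsManifold 𝓘(ℝ, E') ∞ Y]

/-- A family of tangent vectors `ξ n p` at the points `φ (t p)` is smooth. -/
def SmoothFam (φ : M → X) (ξ : 𝒢.Fam E) : Prop :=
  ∀ (n d : ℕ) (p : EuclideanSpace ℝ (Fin d) → 𝒢.Nerve n), IsSmoothFamily p →
    SmoothAlong (fun u => φ (p u).tgt) (fun u => ξ n (p u))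

variable {φ : M → X} {ψ : M → Y} {ξ ζ : 𝒢.Fam E}

theorem SmoothFam.add (hξ : SmoothFam φ ξ) (hζ : SmoothFam φ ζ) : SmoothFam φ (ξ + ζ) :=
  fun n d p hp => (hξ n d p hp).add (hζ n d p hp)

theorem SmoothFam.sgn (hξ : SmoothFam φ ξ) : SmoothFam φ (sgn ξ) :=
  fun n d p hp => SmoothAlong.smul contMDiff_const (hξ n d p hp)

theorem SmoothFam.neg (hξ : SmoothFam φ ξ) : SmoothFam φ (-ξ) :=
  fun n d p hp => SmoothAlong.neg (hξ n d p hp)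

/-- The predicate `Q` carries the condition that vectors lie in A: the quasi-action on A is shown to
be smooth only there, where left translation multiplies composable tangent vectors. -/
theorem SmoothFam.shift (hψ : ContMDiff 𝓘(ℝ, EM) 𝓘(ℝ, E') ∞ ψ) {P : G → E →L[ℝ] E'}
    (Q : G → E → Prop) (hξ : SmoothFam φ ξ)
    (hP : ∀ (d : ℕ) (g : EuclideanSpace ℝ (Fin d) → G) (v : EuclideanSpace ℝ (Fin d) → E),
      ContMDiff 𝓘(ℝ, EuclideanSpace ℝ (Fin d)) 𝓘(ℝ, EG) ∞ g →
      SmoothAlong (fun u => φ (𝒢.s (g u))) v → (∀ u, Q (g u) (v u)) →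
      SmoothAlong (fun u => ψ (𝒢.t (g u))) (fun u => P (g u) (v u)))
    (hQ : ∀ n (p : 𝒢.Nerve (n + 1)), Q (p.arr 0) (ξ n (p.face 0))) :
    SmoothFam ψ (shift P ξ) := by
  intro n d p hp
  cases n with
  | zero => exact SmoothAlong.zero (hψ.comp (hp.1 0))
  | succ n =>
    refine (hP d (fun u => (p u).arr 0) (fun u => ξ n ((p u).face 0)) (hp.2 0)
      ((hξ n d _ (hp.face 0)).congr (fun u => ?_) (fun _ => rfl)) fun u => hQ n (p u)).congr
      (fun u => ?_) (fun _ => rfl)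
    · rw [Nerve.tgt_face_zero]
    · rw [Nerve.t_arr_zero]

theorem SmoothFam.shift₂ (hψ : ContMDiff 𝓘(ℝ, EM) 𝓘(ℝ, E') ∞ ψ) {K : G → G → E →L[ℝ] E'}
    (hξ : SmoothFam φ ξ)
    (hK : ∀ (d : ℕ) (g h : EuclideanSpace ℝ (Fin d) → G) (v : EuclideanSpace ℝ (Fin d) → E),
      ContMDiff 𝓘(ℝ, EuclideanSpace ℝ (Fin d)) 𝓘(ℝ, EG) ∞ g →
      ContMDiff 𝓘(ℝ, EuclideanSpace ℝ (Fin d)) 𝓘(ℝ, EG) ∞ h →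
      (∀ u, 𝒢.s (g u) = 𝒢.t (h u)) → SmoothAlong (fun u => φ (𝒢.s (h u))) v →
      SmoothAlong (fun u => ψ (𝒢.t (g u))) (fun u => K (g u) (h u) (v u))) :
    SmoothFam ψ (shift₂ K ξ) := by
  intro n d p hp
  rcases n with _ | _ | n
  · exact SmoothAlong.zero (hψ.comp (hp.1 0))
  · exact SmoothAlong.zero (hψ.comp (hp.1 0))
  · refine (hK d (fun u => (p u).arr 0) (fun u => (p u).arr 1)
      (fun u => ξ n (((p u).face 0).face 0)) (hp.2 0) (hp.2 1) (fun u => (p u).s_arr_zero)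
      ((hξ n d _ ((hp.face 0).face 0)).congr (fun u => ?_) (fun _ => rfl))).congr
      (fun u => ?_) (fun _ => rfl)
    · rw [Nerve.tgt_face_zero_zero]
    · rw [Nerve.t_arr_zero]

theorem SmoothFam.dhat (hφ : ContMDiff 𝓘(ℝ, EM) 𝓘(ℝ, E) ∞ φ) {Λ : G → E →L[ℝ] E}
    (hξ : SmoothFam φ ξ) (hΛ : SmoothFam φ (LieGroupoid.shift Λ ξ)) :
    SmoothFam φ (dhat Λ ξ) := by
  intro n d p hp
  cases n with
  | zero => exact SmoothAlong.zero (hφ.comp (hp.1 0))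
  | succ n =>
    refine (hΛ (n + 1) d p hp).add ?_
    refine SmoothAlong.sum (c := fun u => φ (p u).tgt) (hφ.comp (hp.1 0)) Finset.univ
      (fun (i : Fin (n + 1)) u => (-1 : ℝ) ^ (i.val + 1) • ξ n ((p u).face i.succ)) fun i _ => ?_
    refine SmoothAlong.smul contMDiff_const ((hξ n d _ (hp.face i.succ)).congr (fun u => ?_)
      (fun _ => rfl))
    rw [Nerve.tgt_face_succ]

end SmoothFam

/-! ### Finiteness of the set of nonzero degrees -/

section Bounded

variable {E E' : Type*} [NormedAddCommGroup E] [NormedSpace ℝ E]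
  [NormedAddCommGroup E'] [NormedSpace ℝ E'] {ξ : 𝒢.Fam E} {N : ℕ}

theorem dhat_bounded (hξ : ∀ n, N ≤ n → ξ n = 0) (Λ : G → E →L[ℝ] E) (n : ℕ) (hn : N + 1 ≤ n) :
    dhat Λ ξ n = 0 := by
  obtain ⟨n, rfl⟩ : ∃ m, n = m + 1 := ⟨n - 1, by omega⟩
  ext p
  simp [dhat_succ, faceSum, hξ n (by omega)]

theorem shift_bounded (hξ : ∀ n, N ≤ n → ξ n = 0) (P : G → E →L[ℝ] E') (n : ℕ) (hn : N + 1 ≤ n) :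
    shift P ξ n = 0 := by
  obtain ⟨n, rfl⟩ : ∃ m, n = m + 1 := ⟨n - 1, by omega⟩
  ext p
  simp [hξ n (by omega)]

theorem shift₂_bounded (hξ : ∀ n, N ≤ n → ξ n = 0) (K : G → G → E →L[ℝ] E') (n : ℕ)
    (hn : N + 2 ≤ n) : shift₂ K ξ n = 0 := by
  obtain ⟨n, rfl⟩ : ∃ m, n = m + 2 := ⟨n - 2, by omega⟩
  ext p
  simp [hξ n (by omega)]

end Bounded

/-! ### Smoothness of the structure maps -/

variable [IsManifold 𝓘(ℝ, EG) ∞ G]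

section Translations

variable {d : ℕ} {g : EuclideanSpace ℝ (Fin d) → G}

theorem smoothAlong_rInvL {W : EuclideanSpace ℝ (Fin d) → EG} (hW : SmoothAlong g W)
    (h0 : ∀ u, 𝒢.sL (g u) (W u) = 0) :
    SmoothAlong (fun u => 𝒢.one (𝒢.t (g u))) (fun u => 𝒢.rInvL (g u) (W u)) := by
  have hz : SmoothAlong (fun u => 𝒢.inv (g u)) (fun _ => (0 : EG)) :=
    SmoothAlong.zero (𝒢.inv_smooth.comp hW.smooth_base)
  exact (hW.groupoid_mul hz (fun u => (𝒢.t_inv _).symm) (fun u => by simp [h0])).congr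
    (fun u => (𝒢.mul_inv _).symm) (fun _ => rfl)

theorem smoothAlong_lTransL (hg : ContMDiff 𝓘(ℝ, EuclideanSpace ℝ (Fin d)) 𝓘(ℝ, EG) ∞ g)
    {a : EuclideanSpace ℝ (Fin d) → EG} (ha : SmoothAlong (fun u => 𝒢.one (𝒢.s (g u))) a)
    (h0 : ∀ u, 𝒢.sL (𝒢.one (𝒢.s (g u))) (a u) = 0) :
    SmoothAlong g (fun u => 𝒢.lTransL (g u) (a u)) := by
  have hz : SmoothAlong g (fun _ => (0 : EG)) := SmoothAlong.zero hg
  have hi : SmoothAlong (fun u => 𝒢.one (𝒢.s (g u)))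
      (fun u => 𝒢.invL (𝒢.one (𝒢.s (g u))) (a u)) :=
    (ha.map 𝒢.inv_smooth).congr (fun u => (𝒢.inv_one _).symm) (fun _ => rfl)
  exact (hz.groupoid_mul hi (fun u => (𝒢.t_one _).symm)
    (fun u => by simp [tL_invL_one (h0 u)])).congr (fun u => (𝒢.mul_one _).symm) (fun _ => rfl)

end Translations

variable [IsManifold 𝓘(ℝ, EM) ∞ M]

namespace Connection

variable {c c' : 𝒢.Connection} {d : ℕ} {g h : EuclideanSpace ℝ (Fin d) → G}

theorem smoothAlong_sigL (hg : ContMDiff 𝓘(ℝ, EuclideanSpace ℝ (Fin d)) 𝓘(ℝ, EG) ∞ g)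
    {X : EuclideanSpace ℝ (Fin d) → EM} (hX : SmoothAlong (fun u => 𝒢.s (g u)) X) :
    SmoothAlong g (fun u => c.sigL (g u) (X u)) :=
  c.smooth d g X hg hX

theorem smoothAlong_omL {V : EuclideanSpace ℝ (Fin d) → EG} (hV : SmoothAlong g V) :
    SmoothAlong (fun u => 𝒢.one (𝒢.t (g u))) (fun u => c.omL (g u) (V u)) := by
  refine smoothAlong_rInvL ?_ fun u => sL_sub_sigL (c := c) (g u) (V u)
  exact (hV.add (SmoothAlong.neg (c.smoothAlong_sigL hV.smooth_base (hV.map 𝒢.s_smooth)))).congr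
    (fun _ => rfl) (fun u => sub_eq_add_neg (V u) _)

theorem smoothAlong_lamTL (hg : ContMDiff 𝓘(ℝ, EuclideanSpace ℝ (Fin d)) 𝓘(ℝ, EG) ∞ g)
    {X : EuclideanSpace ℝ (Fin d) → EM} (hX : SmoothAlong (fun u => 𝒢.s (g u)) X) :
    SmoothAlong (fun u => 𝒢.t (g u)) (fun u => c.lamTL (g u) (X u)) :=
  (c.smoothAlong_sigL hg hX).map 𝒢.t_smooth

theorem smoothAlong_lamAL (hg : ContMDiff 𝓘(ℝ, EuclideanSpace ℝ (Fin d)) 𝓘(ℝ, EG) ∞ g)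
    {a : EuclideanSpace ℝ (Fin d) → EG} (ha : SmoothAlong (fun u => 𝒢.one (𝒢.s (g u))) a)
    (h0 : ∀ u, 𝒢.sL (𝒢.one (𝒢.s (g u))) (a u) = 0) :
    SmoothAlong (fun u => 𝒢.one (𝒢.t (g u))) (fun u => c.lamAL (g u) (a u)) :=
  SmoothAlong.neg (c.smoothAlong_omL (smoothAlong_lTransL hg ha h0))

theorem smoothAlong_psiL (hg : ContMDiff 𝓘(ℝ, EuclideanSpace ℝ (Fin d)) 𝓘(ℝ, EG) ∞ g)
    {X : EuclideanSpace ℝ (Fin d) → EM} (hX : SmoothAlong (fun u => 𝒢.s (g u)) X) :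
    SmoothAlong (fun u => 𝒢.one (𝒢.t (g u))) (fun u => c.psiL c' (g u) (X u)) := by
  refine smoothAlong_rInvL ?_ fun u => sL_sigL_sub_sigL (c := c) (c' := c') (g u) (X u)
  exact ((c.smoothAlong_sigL hg hX).add (SmoothAlong.neg (c'.smoothAlong_sigL hg hX))).congr
    (fun _ => rfl) (fun u => sub_eq_add_neg (c.sigL (g u) (X u)) _)

theorem smoothAlong_KL (hg : ContMDiff 𝓘(ℝ, EuclideanSpace ℝ (Fin d)) 𝓘(ℝ, EG) ∞ g)
    (hh : ContMDiff 𝓘(ℝ, EuclideanSpace ℝ (Fin d)) 𝓘(ℝ, EG) ∞ h)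
    (hc : ∀ u, 𝒢.s (g u) = 𝒢.t (h u))
    {X : EuclideanSpace ℝ (Fin d) → EM} (hX : SmoothAlong (fun u => 𝒢.s (h u)) X) :
    SmoothAlong (fun u => 𝒢.one (𝒢.t (g u))) (fun u => c.KL (g u) (h u) (X u)) := by
  have h1 := c.smoothAlong_sigL hg ((c.smoothAlong_lamTL hh hX).congr hc (fun _ => rfl))
  have h2 := h1.groupoid_mul (smoothAlong_sigL (c := c) hh hX) hc
    fun u => composable_sigL (g u) (h u) (X u)
  exact (c.smoothAlong_omL h2).congr (fun u => by rw [𝒢.t_mul _ _ (hc u)]) (fun _ => rfl)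

end Connection

theorem smoothFam_fib_anchorL {a : 𝒢.Fam EG} (ha : SmoothFam 𝒢.one a) :
    SmoothFam (fun x : M => x) (fib 𝒢.anchorL a) := fun n d p hp =>
  ((ha n d p hp).map 𝒢.t_smooth).congr (fun _ => (𝒢.t_one _).symm) (fun _ => rfl)

/-! ### The operators preserve smooth cochains -/

theorem mem_adCochain_iff {η : 𝒢.RawCochain} : η ∈ 𝒢.AdCochain ↔
    (∀ n p, 𝒢.sL (𝒢.one p.tgt) (𝒢.fstL η n p) = 0) ∧
    (SmoothFam 𝒢.one (𝒢.fstL η) ∧ SmoothFam (fun x : M => x) (𝒢.sndL η)) ∧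
    ∃ N, ∀ n, N ≤ n → 𝒢.fstL η n = 0 ∧ 𝒢.sndL η n = 0 := by
  refine and_congr Iff.rfl (and_congr ⟨fun h => ⟨fun n d p hp => (h n d p hp).1,
    fun n d p hp => (h n d p hp).2⟩, fun h n d p hp => ⟨h.1 n d p hp, h.2 n d p hp⟩⟩ Iff.rfl)

theorem adOp_mem (c : 𝒢.Connection) {η : 𝒢.RawCochain} (hη : η ∈ 𝒢.AdCochain) :
    adOp c η ∈ 𝒢.AdCochain := by
  rw [mem_adCochain_iff] at hη ⊢
  obtain ⟨hA, ⟨ha, hb⟩, N, hN⟩ := hη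
  have hN1 : ∀ n, N ≤ n → 𝒢.fstL η n = 0 := fun n hn => (hN n hn).1
  have hN2 : ∀ n, N ≤ n → 𝒢.sndL η n = 0 := fun n hn => (hN n hn).2
  rw [fstL_adOp, sndL_adOp]
  -- The bound grows by two because K raises the nerve degree by two.
  refine ⟨fun n p => ?_, ⟨?_, ?_⟩, N + 2, fun n hn => ⟨?_, ?_⟩⟩
  · have h1 : 𝒢.sL (𝒢.one p.tgt) (dhat c.lamAL (𝒢.fstL η) n p) = 0 := by
      cases n with
      | zero => simp
      | succ n =>
        have h2 := Connection.sL_lamAL (c := c) (p.arr 0) (𝒢.fstL η n (p.face 0))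
        rw [p.t_arr_zero] at h2
        have h3 : ∀ i : Fin (n + 1), 𝒢.sL (𝒢.one p.tgt) (𝒢.fstL η n (p.face i.succ)) = 0 :=
          fun i => by rw [← p.tgt_face_succ i, hA]
        rw [dhat_succ, map_add, h2, faceSum, map_sum]
        simp [h3]
    have h2 : 𝒢.sL (𝒢.one p.tgt) (shift₂ c.KL (𝒢.sndL η) n p) = 0 := by
      rcases n with _ | _ | n
      · simp
      · simp
      · have h3 := Connection.sL_KL (c := c) p.s_arr_zero (𝒢.sndL η n ((p.face 0).face 0))
        rwa [p.t_arr_zero] at h3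
    simp [h1, h2]
  · refine SmoothFam.add ((SmoothFam.dhat 𝒢.one_smooth ha ?_).sgn.neg) ?_
    · refine SmoothFam.shift 𝒢.one_smooth (fun g v => 𝒢.sL (𝒢.one (𝒢.s g)) v = 0) ha
        (fun d g v hg hv h0 => c.smoothAlong_lamAL hg hv h0) fun n p => ?_
      rw [← p.tgt_face_zero, hA]
    · exact SmoothFam.shift₂ 𝒢.one_smooth hb
        fun d g h v hg hh hc hv => c.smoothAlong_KL hg hh hc hv
  · refine (smoothFam_fib_anchorL ha).add (SmoothFam.sgn (SmoothFam.dhat contMDiff_id hb ?_))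
    exact SmoothFam.shift contMDiff_id (fun _ _ => True) hb
      (fun d g v hg hv _ => c.smoothAlong_lamTL hg hv) fun _ _ => trivial
  · ext p
    simp [dhat_bounded hN1 c.lamAL n (by omega), shift₂_bounded hN2 c.KL n hn]
  · ext p
    simp [dhat_bounded hN2 c.lamTL n (by omega), hN1 n (by omega)]

theorem psi1Op_mem (c c' : 𝒢.Connection) {η : 𝒢.RawCochain} (hη : η ∈ 𝒢.AdCochain) :
    psi1Op c c' η ∈ 𝒢.AdCochain := by
  rw [mem_adCochain_iff] at hη ⊢
  obtain ⟨hA, ⟨ha, hb⟩, N, hN⟩ := hη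
  rw [fstL_psi1Op, sndL_psi1Op]
  refine ⟨fun n p => ?_, ⟨?_, ?_⟩, N + 1, fun n hn => ⟨?_, rfl⟩⟩
  · cases n with
    | zero => simp
    | succ n =>
      have h := Connection.sL_psiL (c := c) (c' := c') (p.arr 0) (𝒢.sndL η n (p.face 0))
      rw [p.t_arr_zero] at h
      simp [h]
  · exact (SmoothFam.shift 𝒢.one_smooth (fun _ _ => True) hb
      (fun d g v hg hv _ => c.smoothAlong_psiL hg hv) fun _ _ => trivial).sgn
  · exact fun n d p hp => SmoothAlong.zero (hp.1 0)
  · ext p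
    simp [shift_bounded (fun n hn => (hN n hn).2) (c.psiL c') n hn]

/-! ### The adjoint representation -/

/-- The adjoint representation `Ad_σ(G)`. -/
def adRep (c : 𝒢.Connection) : 𝒢.AdRep where
  D :=
    { toFun := fun η => ⟨adOp c η.1, adOp_mem c η.2⟩
      map_add' := fun η ζ => Subtype.ext (adOp_add c η.1 ζ.1)
      map_smul' := fun r η => Subtype.ext (adOp_smul c r η.1) }
  degree_one n η hη := by
    have h1 : ∀ k, k ≠ n → 𝒢.fstL η.1 k = 0 := hη.1
    have h2 : ∀ k, k + 1 ≠ n → 𝒢.sndL η.1 k = 0 := hη.2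
    have h3 : ∀ k, k ≠ n + 1 → 𝒢.fstL (adOp c η.1) k = 0 := fun k hk => by
      rw [fstL_adOp]
      ext p
      simp only [Pi.add_apply, Pi.neg_apply, sgn_apply, dhat_concentrated c.lamAL h1 k hk]
      rcases k with _ | _ | k
      · simp
      · simp
      · simp [h2 k (by omega)]
    have h4 : ∀ k, k + 1 ≠ n + 1 → 𝒢.sndL (adOp c η.1) k = 0 := fun k hk => by
      rw [sndL_adOp]
      ext p
      simp only [Pi.add_apply, fib_apply, sgn_apply, h1 k (by omega)]
      cases k with
      | zero => simp
      | succ k => simp [dhat_succ, faceSum, h2 k (by omega)]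
    exact ⟨h3, h4⟩
  sq_zero η := Subtype.ext (adOp_adOp c (mem_adCochain_iff.1 η.2).1)
  leibniz n η f hf hη := adOp_rawStar c hη f

/-- The morphism `η ↦ η + Ψ₁ ⋆ η` of adjoint representations. -/
def adRepHom (c c' : 𝒢.Connection) : AdRep.Hom (adRep c) (adRep c') where
  toLin :=
    { toFun := fun η => ⟨η.1 + psi1Op c c' η.1, add_mem η.2 (psi1Op_mem c c' η.2)⟩
      map_add' := fun η ζ => Subtype.ext <| by
        simp only [Submodule.coe_add, psi1Op_add]
        abel
      map_smul' := fun r η => Subtype.ext <| by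
        simp only [Submodule.coe_smul, psi1Op_smul, RingHom.id_apply, smul_add] }
  degree_zero n η hη := by
    have h1 : ∀ k, k ≠ n → 𝒢.fstL η.1 k = 0 := hη.1
    have h2 : ∀ k, k + 1 ≠ n → 𝒢.sndL η.1 k = 0 := hη.2
    have h3 : ∀ k, k ≠ n → 𝒢.fstL (η.1 + psi1Op c c' η.1) k = 0 := fun k hk => by
      rw [map_add, fstL_psi1Op]
      ext p
      simp only [Pi.add_apply, sgn_apply, h1 k hk]
      cases k with
      | zero => simp
      | succ k => simp [h2 k hk]
    have h4 : ∀ k, k + 1 ≠ n → 𝒢.sndL (η.1 + psi1Op c c' η.1) k = 0 := fun k hk => by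
      rw [map_add, sndL_psi1Op, add_zero, h2 k hk]
    exact ⟨h3, h4⟩
  map_star η f hf := Subtype.ext <| by
    have h : rawStar η.1 f + psi1Op c c' (rawStar η.1 f) = rawStar (η.1 + psi1Op c c' η.1) f := by
      rw [psi1Op_rawStar]
      refine rawCochain_ext ?_ ?_
      · simp only [map_add, fstL_rawStar, starFam_add]
      · simp only [map_add, sndL_rawStar, starFam_add]
    exact h
  comm η := Subtype.ext (adOp_add_psi1Op c c' (mem_adCochain_iff.1 η.2).1)

theorem adRepHom_adRepHom (c c' : 𝒢.Connection) (η : 𝒢.AdCochain) :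
    (adRepHom c' c).toLin ((adRepHom c c').toLin η) = η := by
  refine Subtype.ext ?_
  change η.1 + psi1Op c c' η.1 + psi1Op c' c (η.1 + psi1Op c c' η.1) = η.1
  rw [psi1Op_add, psi1Op_psi1Op, psi1Op_swap, add_zero, neg_add_cancel_right]

/-- The canonical isomorphism between the adjoint representations of two connections. -/
def adRepIso (c c' : 𝒢.Connection) : AdRep.Iso (adRep c) (adRep c') where
  hom := adRepHom c c'
  inv := adRepHom c' c
  hom_inv := adRepHom_adRepHom c c'
  inv_hom := adRepHom_adRepHom c' c

end LieGroupoid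

end

/-! ### The proposition -/

theorem mainTheorem6
    {EM : Type*} [NormedAddCommGroup EM] [NormedSpace ℝ EM] [FiniteDimensional ℝ EM]
    {EG : Type*} [NormedAddCommGroup EG] [NormedSpace ℝ EG] [FiniteDimensional ℝ EG]
    {M : Type*} [TopologicalSpace M] [ChartedSpace EM M] [IsManifold 𝓘(ℝ, EM) ∞ M]
    {G : Type*} [TopologicalSpace G] [ChartedSpace EG G] [IsManifold 𝓘(ℝ, EG) ∞ G]
    (𝒢 : LieGroupoid EM EG M G) (σ σ' : 𝒢.Connection) :
    ∃ R R' : 𝒢.AdRep, R.IsAdjoint σ ∧ R'.IsAdjoint σ' ∧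
      ∃ Ψ : LieGroupoid.AdRep.Iso R R',
        (∀ η : 𝒢.AdCochain, (Ψ.hom.toLin η : 𝒢.RawCochain)
          = η.1 + LieGroupoid.psi1Op σ σ' η.1) ∧
        (∀ η : 𝒢.AdCochain, (Ψ.inv.toLin η : 𝒢.RawCochain)
          = η.1 - LieGroupoid.psi1Op σ σ' η.1) := by
  refine ⟨LieGroupoid.adRep σ, LieGroupoid.adRep σ', fun _ => rfl, fun _ => rfl,
    LieGroupoid.adRepIso σ σ', fun _ => rfl, fun η => ?_⟩
  -- The inverse was built as the morphism for the exchanged pair (σ', σ), whose Ψ₁ is the negative.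
  rw [sub_eq_add_neg, ← LieGroupoid.psi1Op_swap]
  rfl
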